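/- **Model.** A base station serves $K$ users from queues, in slots of $T_{\rm slot}>0$ channel uses. The channel states ${\bf h}(t)$ are i.i.d. with values in a finite set $\mathcal H$; state ${\bf h}$ has probability $\phi_{\bf h}$ and gains $h_1,\dots,h_K\ge 0$. Files have $F>0$ bits, each user caches a fraction $m\in[0,1]$ of every file (decentralized placement), the power is $P>0$, and $\sigma_{\max}\in\mathbb N$. Below, $\mathcal I,\mathcal J$ range over the nonempty subsets of $\{1,\dots,K\}$. The capacity region $\Gamma({\bf h})$ is, when the users are ranked so that $h_1\ge\dots\ge h_K$, the set of all $(R_{\mathcal J})_{\mathcal J}\ge 0$ for which there are powers $p_1,\dots,p_K\ge 0$ with $\sum_k p_k\le P$ and $$\sum_{\mathcal J\subseteq\{1,\dots,k\}:\,k\in\mathcal J}R_{\mathcal J}\le\log_2\frac{1+h_k\sum_{j\le k}p_j}{1+h_k\sum_{j<k}p_j},\qquad k=1,\dots,K.$$ For $\mathcal I\subseteq\mathcal J$ let $b_{\mathcal J,\mathcal I}=m^{|\mathcal I|-1}(1-m)^{|\mathcal J|-|\mathcal I|+1}F$, the number of bits for the users in $\mathcal I$ created when files of the users in $\mathcal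 J$ are combined. In slot $t$ a causal, possibly randomized and history-dependent policy, knowing ${\bf h}(t)$, chooses admissions $a_k(t)\in\mathbb N$, numbers of combinations $\sigma_{\mathcal J}(t)\in\{0,\dots,\sigma_{\max}\}$ and rates $\mu(t)\in\Gamma({\bf h}(t))$. Starting from arbitrary fixed contents, the user queues and codeword queues evolve as $$S_k(t+1)=\Big[S_k(t)-\sum_{\mathcal J\ni k}\sigma_{\mathcal J}(t)\Big]^++a_k(t),\qquad Q_{\mathcal I}(t+1)=\big[Q_{\mathcal I}(t)-T_{\rm slot}\,\mu_{\mathcal I}(t)\big]^++\sum_{\mathcal J\supseteq\mathcal I}b_{\mathcal J,\mathcal I}\,\sigma_{\mathcal J}(t).$$ A queue $X$ is (strongly) stable if $\limsup_{T}\frac1T\sum_{t<T}\mathbb E[X(t)]<\infty$; the system is stable if all queues are. The admission-rate vector of a policy is $\bar a\in\mathbb R_+^K$, $\bar a_k=\limsup_T\frac1T\sum_{t<T}\mathbb E[a_k(t)]$, where these $K$ limits superior are required to be attained along a common sequence of times $T$ (automatic when the averages converge). The stability region is the set of $\bar a\in\mathbb R_+^K$ which are the admission-rate vector of some policy under which the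 system is stable. **Theorem.** Let $\Gamma^{CC}$ be the set of $\bar a\in\mathbb R_+^K$ for which there exist $\bar\mu\in\sum_{{\bf h}\in\mathcal H}\phi_{\bf h}\Gamma({\bf h})$ and $\bar\sigma_{\mathcal J}\in[0,\sigma_{\max}]$ such that $$\sum_{\mathcal J\ni k}\bar\sigma_{\mathcal J}\ge\bar a_k\ \ (k=1,\dots,K),\qquad T_{\rm slot}\,\bar\mu_{\mathcal I}\ge\sum_{\mathcal J\supseteq\mathcal I}b_{\mathcal J,\mathcal I}\,\bar\sigma_{\mathcal J}\ \ \text{for all }\mathcal I.$$ Then a vector $\bar a\in\mathbb R_+^K$ which is not on the boundary of $\Gamma^{CC}$ belongs to the stability region if and only if it belongs to the interior of $\Gamma^{CC}$ (boundary and interior relative to $\mathbb R_+^K$). Moreover, if some state of positive probability gives all users positive gains, the interior of $\Gamma^{CC}$ is the set of $\bar a\in\mathbb R_+^K$ for which $\bar\mu$ and $\bar\sigma$ as above exist with all of these inequalities strict. -/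

import Mathlib

open MeasureTheory ProbabilityTheory Filter Topology
open scoped NNReal ENNReal

namespace CodedCaching

/-- The nonempty subsets of the set of `K` users. They index the messages, the combinations and
the codeword queues. -/
abbrev UserSet (K : ℕ) : Type := {I : Finset (Fin K) // I.Nonempty}

/-- The capacity region (bits per channel use) of the degraded Gaussian broadcast channel with
total power `P` and gains `h`, with one message for every nonempty set of users.
The users are ranked by decreasing gain: `rk i` is the user of rank `i`, and `p i` is the
power spent on it. The message for `J` is counted at the weakest user of `J`. -/
def capacityRegion {K : ℕ} (P : ℝ) (h : Fin K → ℝ) : Set (UserSet K → ℝ) :=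
  {R | (∀ J, 0 ≤ R J) ∧
    ∃ (rk : Equiv.Perm (Fin K)) (p : Fin K → ℝ),
      Antitone (fun i => h (rk i)) ∧ (∀ i, 0 ≤ p i) ∧ ∑ i, p i ≤ P ∧
      ∀ i : Fin K,
        ∑ J : UserSet K with rk i ∈ J.1 ∧ ∀ k ∈ J.1, rk.symm k ≤ i, R J ≤
          Real.logb 2 ((1 + h (rk i) * ∑ j with j ≤ i, p j) /
            (1 + h (rk i) * ∑ j with j < i, p j))}

/-- The data of the queued delivery network with `K` users and finite set `H` of channel
states. -/
structure Network (K : ℕ) (H : Type*) [Fintype H] where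
  /-- `gain s k` is the channel gain of user `k` in state `s` -/
  gain : H → Fin K → ℝ
  gain_nonneg : ∀ s k, 0 ≤ gain s k
  /-- the probability of each channel state -/
  prob : H → ℝ
  prob_nonneg : ∀ s, 0 ≤ prob s
  prob_sum : ∑ s, prob s = 1
  /-- the power constraint -/
  power : ℝ
  power_pos : 0 < power
  /-- the number of channel uses per slot -/
  slot : ℝ
  slot_pos : 0 < slot
  /-- the file size in bits -/
  fileSize : ℝ
  fileSize_pos : 0 < fileSize
  /-- the normalized cache memory, i.e. the fraction of each file that each user caches -/
  memory : ℝ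
  memory_nonneg : 0 ≤ memory
  memory_le_one : memory ≤ 1
  /-- the largest number of combinations of a given set of users in one slot -/
  combMax : ℕ
  /-- the initial contents (files) of the user queues -/
  userInit : Fin K → ℕ
  /-- the initial contents (bits) of the codeword queues -/
  codeInit : UserSet K → ℝ≥0

namespace Network

variable {K : ℕ} {H : Type*} [Fintype H] (net : Network K H)

/-- The number of bits for the users in `I` that decentralized coded caching generates from one
combination of files of the users in `J`, for `I ⊆ J`: the bits of a file of a user `k ∈ I` which,
among the users of `J`, are cached exactly by those of `I \ {k}`. -/
def bits (J I : UserSet K) : ℝ :=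
  net.fileSize * net.memory ^ (I.1.card - 1) * (1 - net.memory) ^ (J.1.card - I.1.card + 1)

/-- The capacity region averaged over the channel states (a weighted Minkowski sum). -/
def avgCapacity : Set (UserSet K → ℝ) :=
  {u | ∃ r : H → UserSet K → ℝ,
    (∀ s, r s ∈ capacityRegion net.power (net.gain s)) ∧ u = ∑ s, net.prob s • r s}

/-- The region `Γ^CC`, a subset of the space `ℝ₊^K` of rate vectors. -/
def region : Set (Fin K → ℝ≥0) :=
  {a | ∃ (c u : UserSet K → ℝ),
    (∀ J, 0 ≤ c J ∧ c J ≤ net.combMax) ∧ u ∈ net.avgCapacity ∧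
    (∀ k, (a k : ℝ) ≤ ∑ J : UserSet K with k ∈ J.1, c J) ∧
    ∀ I : UserSet K, ∑ J : UserSet K with I.1 ⊆ J.1, net.bits J I * c J ≤ net.slot * u I}

/-- The rate vectors which satisfy the constraints of `region` with strict inequalities. -/
def strictRegion : Set (Fin K → ℝ≥0) :=
  {a | ∃ (c u : UserSet K → ℝ),
    (∀ J, 0 ≤ c J ∧ c J ≤ net.combMax) ∧ u ∈ net.avgCapacity ∧
    (∀ k, (a k : ℝ) < ∑ J : UserSet K with k ∈ J.1, c J) ∧
    ∀ I : UserSet K, ∑ J : UserSet K with I.1 ⊆ J.1, net.bits J I * c J < net.slot * u I}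

/-- The network run under a (possibly randomized and history dependent) causal control policy. -/
structure ControlledSystem where
  Ω : Type
  [measurableSpace : MeasurableSpace Ω]
  law : Measure Ω
  [isProbabilityMeasure : IsProbabilityMeasure law]
  /-- `info t`: the channel states, decisions and randomization up to and including slot `t` -/
  info : Filtration ℕ measurableSpace
  /-- the channel state in slot `t` -/
  channel : ℕ → Ω → H
  /-- the number of files admitted for user `k` in slot `t` -/
  admitted : ℕ → Fin K → Ω → ℕ
  /-- the number of combinations of files of the users in `J` in slot `t` -/
  comb : ℕ → UserSet K → Ω → ℕ
  /-- the number of bits per channel use sent to the users in `I` in slot `t` -/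
  rate : ℕ → UserSet K → Ω → ℝ
  channel_measurable : ∀ t, @Measurable _ _ (info t) ⊤ (channel t)
  admitted_measurable : ∀ t k, Measurable[info t] (admitted t k)
  comb_measurable : ∀ t J, Measurable[info t] (comb t J)
  rate_measurable : ∀ t I, Measurable[info t] (rate t I)
  /-- the channel is i.i.d., and its next state is independent of everything that happened -/
  channel_law : ∀ t s, law {ω | channel t ω = s} = ENNReal.ofReal (net.prob s)
  channel_indep : ∀ t, Indep (info t) (MeasurableSpace.comap (channel (t + 1)) ⊤) law
  comb_le : ∀ t J ω, comb t J ω ≤ net.combMax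
  rate_mem : ∀ t ω, (fun I => rate t I ω) ∈ capacityRegion net.power (net.gain (channel t ω))

attribute [instance] ControlledSystem.measurableSpace ControlledSystem.isProbabilityMeasure

end Network

/-- The average over the slots `0, …, T - 1` of the expectation of a nonnegative process. -/
noncomputable def timeAverage {Ω : Type*} [MeasurableSpace Ω] (law : Measure Ω) (X : ℕ → Ω → ℝ)
    (T : ℕ) : ℝ≥0∞ :=
  (∑ t ∈ Finset.range T, ∫⁻ ω, ENNReal.ofReal (X t ω) ∂law) / (T : ℝ≥0∞)

/-- Strong stability of a queue. -/
def StronglyStable {Ω : Type*} [MeasurableSpace Ω] (law : Measure Ω) (X : ℕ → Ω → ℝ) : Prop :=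
  limsup (timeAverage law X) atTop < ⊤

namespace Network

variable {K : ℕ} {H : Type*} [Fintype H] {net : Network K H}

namespace ControlledSystem

variable (sys : net.ControlledSystem)

/-- The number of files in the user queue of `k` at slot `t`. -/
def userQueue (k : Fin K) : ℕ → sys.Ω → ℝ
  | 0, _ => net.userInit k
  | t + 1, ω =>
      max (userQueue k t ω - ∑ J : UserSet K with k ∈ J.1, (sys.comb t J ω : ℝ)) 0
        + sys.admitted t k ω

/-- The number of bits in the codeword queue of `I` at slot `t`. -/
def codeQueue (I : UserSet K) : ℕ → sys.Ω → ℝ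
  | 0, _ => net.codeInit I
  | t + 1, ω =>
      max (codeQueue I t ω - net.slot * sys.rate t I ω) 0
        + ∑ J : UserSet K with I.1 ⊆ J.1, net.bits J I * (sys.comb t J ω : ℝ)

/-- All queues are strongly stable. -/
def Stable : Prop :=
  (∀ k, StronglyStable sys.law (sys.userQueue k)) ∧ ∀ I, StronglyStable sys.law (sys.codeQueue I)

/-- The average expected number of files admitted for user `k` per slot, up to time `T`. -/
noncomputable def admissionAverage (k : Fin K) (T : ℕ) : ℝ≥0∞ :=
  timeAverage sys.law (fun t ω => (sys.admitted t k ω : ℝ)) T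

/-- `a` is the admission-rate vector: each `a k` is the limit superior of the average number of
files admitted for user `k`, and these limits superior are attained along a common sequence of
times (which is automatic if the averages converge, or if there is one user). -/
def HasAdmissionRate (a : Fin K → ℝ≥0) : Prop :=
  (∀ k, limsup (sys.admissionAverage k) atTop = (a k : ℝ≥0∞)) ∧
  ∃ n : ℕ → ℕ, Tendsto n atTop atTop ∧
    ∀ k, Tendsto (fun i => sys.admissionAverage k (n i)) atTop (𝓝 (a k : ℝ≥0∞))

end ControlledSystem

variable (net)

/-- The admission-rate vectors for which some policy makes all queues stable. -/
def stabilityRegion : Set (Fin K → ℝ≥0) :=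
  {a | ∃ sys : net.ControlledSystem, sys.HasAdmissionRate a ∧ sys.Stable}

end Network

end CodedCaching

/-! Necessity: in a stable system the expected queue lengths are o(T), so up to a vanishing term the
average arrivals of each queue are at most its average departures. The average mean decisions lie in
a compact convex set: the box of combination numbers times the averaged capacity region. A limit
point, along times at which all admission averages converge, witnesses membership in `region`
(`stabilityRegion_subset_region`).

Sufficiency: at an interior point the combination numbers can be shrunk by a factor `1 - δ` and
still support the admissions (`exists_slack`). A policy that ignores the queues then suffices:
admissions and combinations follow deterministic integer sequences of the right average, and rates
depend on the channel state only. User queues stay bounded; codeword queues are either never fed or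
have negative quadratic Lyapunov drift (`stronglyStable_of_drift`).

Both the compactness argument and the passage to expected rates need `capacityRegion` to be closed
and convex. This is not evident from its definition, which quantifies over rankings and powers.
Eliminating the powers leaves one inequality, that the least total power is at most `P`, and this
power is convex in the rates (`capacityRegion_eq`, `convex_powerRegion`). -/

namespace CodedCaching

/-! ### The capacity region through its least total power: closed, convex, bounded. -/

/-- The least cumulative power of the first `m` ranks which allows for the rates `x`, when the
user of rank `i` has noise level `w (i + 1)`. -/
noncomputable def cumPower (w x : ℕ → ℝ) : ℕ → ℝ
  | 0 => 0
  | m + 1 => 2 ^ x m * (w (m + 1) + cumPower w x m) - w (m + 1)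

/-- With `w m` added, the recursion becomes multiplication by `2 ^ x m` after an injection of `w (m
+ 1) - w m`, and unrolls to a sum of exponentials of linear forms. For increasing `w` the
coefficients are nonnegative, which is the source of convexity. -/
lemma cumPower_add (w x : ℕ → ℝ) (hw : w 0 = 0) (m : ℕ) :
    cumPower w x m + w m =
      ∑ i ∈ Finset.range m, (w (i + 1) - w i) * 2 ^ (∑ j ∈ Finset.Ico i m, x j) := by
  induction m with
  | zero => simp [cumPower, hw]
  | succ m ih =>
    have h1 : ∀ i ∈ Finset.range m,
        (w (i + 1) - w i) * (2 : ℝ) ^ (∑ j ∈ Finset.Ico i (m + 1), x j) =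
          2 ^ x m * ((w (i + 1) - w i) * 2 ^ (∑ j ∈ Finset.Ico i m, x j)) := by
      intro i hi
      rw [Finset.sum_Ico_succ_top (Finset.mem_range.1 hi).le, Real.rpow_add two_pos]
      ring
    rw [Finset.sum_range_succ, Finset.sum_congr rfl h1, ← Finset.mul_sum, ← ih]
    simp only [cumPower, Nat.Ico_succ_singleton, Finset.sum_singleton]
    ring

/-- Each constraint bounds the next cumulative power from below by an increasing function of the
previous one, so meeting all of them with equality is optimal. -/
lemma cumPower_le {w x q : ℕ → ℝ} {K : ℕ} (h0 : 0 ≤ q 0)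
    (h : ∀ i < K, 2 ^ x i * (w (i + 1) + q i) ≤ w (i + 1) + q (i + 1)) :
    ∀ m ≤ K, cumPower w x m ≤ q m := by
  intro m
  induction m with
  | zero => intro _; simpa [cumPower] using h0
  | succ m ih =>
    intro hm
    have h1 := ih (by omega)
    have h2 := h m (by omega)
    have h3 : (2 : ℝ) ^ x m * (w (m + 1) + cumPower w x m) ≤ 2 ^ x m * (w (m + 1) + q m) := by
      gcongr
    simp only [cumPower]
    linarith

lemma cumPower_monotone {w x : ℕ → ℝ} (hw : ∀ i, 0 ≤ w i) (hx : ∀ i, 0 ≤ x i) :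
    Monotone (cumPower w x) := by
  have h : ∀ m, 0 ≤ cumPower w x m ∧ cumPower w x m ≤ cumPower w x (m + 1) := by
    intro m
    have key : ∀ m, 0 ≤ cumPower w x m → cumPower w x m ≤ cumPower w x (m + 1) := by
      intro m hm
      have h1 : (1 : ℝ) ≤ 2 ^ x m := Real.one_le_rpow (by norm_num) (hx m)
      have h2 := mul_le_mul_of_nonneg_right h1 (add_nonneg (hw (m + 1)) hm)
      simp only [cumPower]
      linarith
    induction m with
    | zero => exact ⟨le_rfl, key 0 le_rfl⟩
    | succ m ih => exact ⟨ih.1.trans ih.2, key _ (ih.1.trans ih.2)⟩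
  exact monotone_nat_of_le_succ fun m => (h m).2

section Region

variable {K : ℕ}

/-- The largest rank of a user in `J`. -/
def maxRank (rk : Equiv.Perm (Fin K)) (J : UserSet K) : ℕ :=
  J.1.sup' J.2 (fun k => (rk.symm k : ℕ))

lemma le_maxRank_iff (rk : Equiv.Perm (Fin K)) (J : UserSet K) (i : ℕ) :
    i ≤ maxRank rk J ↔ ∃ k ∈ J.1, i ≤ (rk.symm k : ℕ) := by
  simp [maxRank, Finset.le_sup'_iff]

lemma maxRank_lt (rk : Equiv.Perm (Fin K)) (J : UserSet K) : maxRank rk J < K := by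
  simp [maxRank, Finset.sup'_lt_iff]

lemma maxRank_eq_iff (rk : Equiv.Perm (Fin K)) (J : UserSet K) (i : Fin K) :
    maxRank rk J = i ↔ rk i ∈ J.1 ∧ ∀ k ∈ J.1, rk.symm k ≤ i := by
  constructor
  · intro h
    have hle : ∀ k ∈ J.1, rk.symm k ≤ i := by
      intro k hk
      have := (le_maxRank_iff rk J (rk.symm k)).2 ⟨k, hk, le_rfl⟩
      rw [h] at this
      exact this
    obtain ⟨k, hk, hik⟩ := (le_maxRank_iff rk J i).1 h.ge
    have : rk.symm k = i := le_antisymm (hle k hk) hik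
    refine ⟨?_, hle⟩
    rw [← this]
    simpa using hk
  · rintro ⟨h1, h2⟩
    apply le_antisymm
    · exact Finset.sup'_le _ _ fun k hk => h2 k hk
    · exact (le_maxRank_iff rk J i).2 ⟨_, h1, by simp⟩

/-- The total rate of the messages which are counted at the user of rank `j`. -/
noncomputable def rankRate (rk : Equiv.Perm (Fin K)) (R : UserSet K → ℝ) (j : ℕ) : ℝ :=
  ∑ J : UserSet K with maxRank rk J = j, R J

lemma rankRate_eq (rk : Equiv.Perm (Fin K)) (R : UserSet K → ℝ) (i : Fin K) :
    rankRate rk R i =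
      ∑ J : UserSet K with rk i ∈ J.1 ∧ ∀ k ∈ J.1, rk.symm k ≤ i, R J := by
  simp only [rankRate, maxRank_eq_iff]

lemma rankRate_nonneg (rk : Equiv.Perm (Fin K)) {R : UserSet K → ℝ} (hR : ∀ J, 0 ≤ R J) (j : ℕ) :
    0 ≤ rankRate rk R j :=
  Finset.sum_nonneg fun J _ => hR J

lemma sum_rankRate (rk : Equiv.Perm (Fin K)) (R : UserSet K → ℝ) (i : ℕ) :
    ∑ j ∈ Finset.Ico i K, rankRate rk R j = ∑ J : UserSet K with i ≤ maxRank rk J, R J := by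
  simp only [rankRate, Finset.sum_filter]
  rw [Finset.sum_comm]
  refine Finset.sum_congr rfl fun J _ => ?_
  have := maxRank_lt rk J
  simp [this]

/-- The noise level of a user; users with zero gain get a value that is larger than all the
others. -/
noncomputable def noise (h : Fin K → ℝ) (k : Fin K) : ℝ :=
  -- Since `0⁻¹ = 0`, the sum is over positive gains and dominates each of their inverses. The
  -- finite value does no harm: messages to a user of zero gain have rate zero anyway.
  if h k = 0 then ∑ j, (h j)⁻¹ else (h k)⁻¹

lemma noise_nonneg {h : Fin K → ℝ} (hh : ∀ k, 0 ≤ h k) (k : Fin K) : 0 ≤ noise h k := by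
  unfold noise
  split_ifs
  · exact Finset.sum_nonneg fun j _ => inv_nonneg.2 (hh j)
  · exact inv_nonneg.2 (hh k)

lemma noise_anti {h : Fin K → ℝ} (hh : ∀ k, 0 ≤ h k) {j k : Fin K} (hjk : h k ≤ h j) :
    noise h j ≤ noise h k := by
  unfold noise
  by_cases hk : h k = 0
  · rw [if_pos hk]
    split_ifs
    · exact le_rfl
    · exact Finset.single_le_sum (f := fun j => (h j)⁻¹) (fun i _ => inv_nonneg.2 (hh i))
        (Finset.mem_univ j)
  · have hk' : 0 < h k := lt_of_le_of_ne (hh k) (Ne.symm hk)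
    rw [if_neg hk, if_neg (hk'.trans_le hjk).ne']
    exact inv_anti₀ hk' hjk

/-- The noise levels in the order of the ranks, shifted by one and starting with `0`. -/
noncomputable def rankNoise (h : Fin K → ℝ) (rk : Equiv.Perm (Fin K)) : ℕ → ℝ
  | 0 => 0
  | i + 1 => if hi : i < K then noise h (rk ⟨i, hi⟩) else 0

lemma rankNoise_nonneg {h : Fin K → ℝ} (hh : ∀ k, 0 ≤ h k) (rk : Equiv.Perm (Fin K)) (i : ℕ) :
    0 ≤ rankNoise h rk i := by
  cases i with
  | zero => exact le_rfl
  | succ i =>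
    simp only [rankNoise]
    split_ifs
    · exact noise_nonneg hh _
    · exact le_rfl

lemma rankNoise_le_succ {h : Fin K → ℝ} (hh : ∀ k, 0 ≤ h k) {rk : Equiv.Perm (Fin K)}
    (hrk : Antitone fun i => h (rk i)) {i : ℕ} (hi : i < K) :
    rankNoise h rk i ≤ rankNoise h rk (i + 1) := by
  cases i with
  | zero => exact rankNoise_nonneg hh rk 1
  | succ i =>
    simp only [rankNoise, hi, (Nat.lt_succ_self i).trans hi, dite_true]
    exact noise_anti hh (hrk (by simp [Fin.le_def]))

lemma rankNoise_eq {h : Fin K → ℝ} {rk rk' : Equiv.Perm (Fin K)}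
    (hrk : Antitone fun i => h (rk i)) (hrk' : Antitone fun i => h (rk' i)) :
    rankNoise h rk = rankNoise h rk' := by
  have h1 : h ∘ rk = h ∘ rk' := Tuple.unique_antitone hrk hrk'
  have h2 : ∀ i, noise h (rk i) = noise h (rk' i) := by
    intro i
    have := congrFun h1 i
    simp only [Function.comp_apply] at this
    simp only [noise, this]
  funext i
  cases i with
  | zero => rfl
  | succ i => simp only [rankNoise, h2]

/-- The rate region described by the least total power that is needed for given rates. -/
def powerRegion (P : ℝ) (h : Fin K → ℝ) (rk : Equiv.Perm (Fin K)) : Set (UserSet K → ℝ) :=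
  {R | (∀ J, 0 ≤ R J) ∧ (∀ J : UserSet K, ∀ k ∈ J.1, h k = 0 → R J = 0) ∧
    ∑ i ∈ Finset.range K, (rankNoise h rk (i + 1) - rankNoise h rk i) *
      2 ^ (∑ J : UserSet K with i ≤ maxRank rk J, R J) ≤ P + rankNoise h rk K}

/-- Rankings differ only among users of equal gain. Where the noise level does not jump, the term
has coefficient zero; where it jumps, `i ≤ maxRank rk J` says that `J` has a user at least as noisy
as the new level, whatever the ranking. Convexity needs this independence, because two points of
`capacityRegion` may come with different rankings. -/
lemma powerRegion_eq {P : ℝ} {h : Fin K → ℝ} (hh : ∀ k, 0 ≤ h k) {rk rk' : Equiv.Perm (Fin K)}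
    (hrk : Antitone fun i => h (rk i)) (hrk' : Antitone fun i => h (rk' i)) :
    powerRegion P h rk = powerRegion P h rk' := by
  have hmem : ∀ (τ : Equiv.Perm (Fin K)), (Antitone fun i => h (τ i)) → ∀ i, i < K →
      rankNoise h τ i < rankNoise h τ (i + 1) → ∀ J : UserSet K,
        (i ≤ maxRank τ J ↔ ∃ k ∈ J.1, rankNoise h τ (i + 1) ≤ noise h k) := by
    intro τ hτ i hi hlt J
    rw [le_maxRank_iff]
    refine exists_congr fun k => and_congr_right fun _ => ?_
    simp only [rankNoise, hi, dite_true]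
    constructor
    · intro hik
      apply noise_anti hh
      have := hτ (show (⟨i, hi⟩ : Fin K) ≤ τ.symm k from hik)
      simpa using this
    · intro hk
      by_contra hcon
      push Not at hcon
      cases i with
      | zero => omega
      | succ i =>
        simp only [rankNoise, hi, (Nat.lt_succ_self i).trans hi, dite_true] at hlt
        have h1 := hτ (show τ.symm k ≤ ⟨i, (Nat.lt_succ_self i).trans hi⟩ from by
          rw [Fin.le_def]; exact Nat.lt_succ_iff.1 hcon)
        simp only [Equiv.apply_symm_apply] at h1
        have := noise_anti hh h1
        linarith
  have hn := rankNoise_eq hrk hrk'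
  ext R
  simp only [powerRegion, Set.mem_ofPred_eq]
  refine and_congr_right fun _ => and_congr_right fun _ => ?_
  rw [← hn]
  suffices hs : ∀ i ∈ Finset.range K, (rankNoise h rk (i + 1) - rankNoise h rk i) *
      (2 : ℝ) ^ (∑ J : UserSet K with i ≤ maxRank rk J, R J) =
      (rankNoise h rk (i + 1) - rankNoise h rk i) *
      2 ^ (∑ J : UserSet K with i ≤ maxRank rk' J, R J) by
    rw [Finset.sum_congr rfl hs]
  intro i hi
  have hi := Finset.mem_range.1 hi
  rcases (rankNoise_le_succ hh hrk hi).eq_or_lt with he | hlt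
  · rw [he]; simp
  · have h1 := hmem rk hrk i hi hlt
    have h2 := hmem rk' hrk' i hi (by rwa [← hn])
    rw [← hn] at h2
    congr 3
    ext J
    simp only [Finset.mem_filter, Finset.mem_univ, true_and]
    rw [h1, h2]

/-- Exponentiating and dividing by the gain makes the rate constraint linear in the cumulative
powers, in the form of the recursion of `cumPower`. -/
lemma le_logb_div_iff {x a b g : ℝ} (hg : 0 < g) (ha : 0 ≤ a) (hb : 0 ≤ b) :
    x ≤ Real.logb 2 ((1 + g * a) / (1 + g * b)) ↔ 2 ^ x * (g⁻¹ + b) ≤ g⁻¹ + a := by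
  have ha' : 0 < 1 + g * a := by positivity
  have hb' : 0 < 1 + g * b := by positivity
  rw [Real.le_logb_iff_rpow_le one_lt_two (by positivity), le_div_iff₀ hb']
  have e1 : (1 + g * a) = g * (g⁻¹ + a) := by field_simp
  have e2 : (2 : ℝ) ^ x * (1 + g * b) = g * (2 ^ x * (g⁻¹ + b)) := by field_simp
  rw [e1, e2, mul_le_mul_iff_right₀ hg]

lemma powerRegion_iff {P : ℝ} {h : Fin K → ℝ} {rk : Equiv.Perm (Fin K)} {R : UserSet K → ℝ} :
    R ∈ powerRegion P h rk ↔ (∀ J, 0 ≤ R J) ∧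
      (∀ J : UserSet K, ∀ k ∈ J.1, h k = 0 → R J = 0) ∧
      cumPower (rankNoise h rk) (rankRate rk R) K ≤ P := by
  have := cumPower_add (rankNoise h rk) (rankRate rk R) rfl K
  simp only [sum_rankRate] at this
  simp only [powerRegion, Set.mem_ofPred_eq, ← this, add_le_add_iff_right]

lemma mem_powerRegion_of_power {P : ℝ} {h : Fin K → ℝ} (hh : ∀ k, 0 ≤ h k)
    {rk : Equiv.Perm (Fin K)} (hrk : Antitone fun i => h (rk i)) {R : UserSet K → ℝ}
    (hR : ∀ J, 0 ≤ R J) {p : Fin K → ℝ} (hp : ∀ i, 0 ≤ p i) (hP : ∑ i, p i ≤ P)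
    (hle : ∀ i : Fin K,
        ∑ J : UserSet K with rk i ∈ J.1 ∧ ∀ k ∈ J.1, rk.symm k ≤ i, R J ≤
          Real.logb 2 ((1 + h (rk i) * ∑ j with j ≤ i, p j) /
            (1 + h (rk i) * ∑ j with j < i, p j))) :
    R ∈ powerRegion P h rk := by
  have hzero : ∀ J : UserSet K, ∀ k ∈ J.1, h k = 0 → R J = 0 := by
    intro J k hk h0
    -- The weakest user of `J` has gain at most `h k = 0`, so the constraint that counts `J` has
    -- right-hand side `logb 2 1 = 0`.
    set i : Fin K := ⟨maxRank rk J, maxRank_lt rk J⟩ with hi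
    have hki : rk.symm k ≤ i := ((maxRank_eq_iff rk J i).1 rfl).2 k hk
    have h1 : h (rk i) = 0 := by
      have := hrk hki
      simp only [Equiv.apply_symm_apply, h0] at this
      exact le_antisymm this (hh _)
    have h2 := hle i
    rw [← rankRate_eq, h1] at h2
    simp only [zero_mul, add_zero, div_one, Real.logb_one] at h2
    have h3 : R J ≤ rankRate rk R i :=
      Finset.single_le_sum (f := R) (fun J _ => hR J) (by simp [hi])
    exact le_antisymm (h3.trans h2) (hR J)
  refine powerRegion_iff.2 ⟨hR, hzero, ?_⟩
  set q : ℕ → ℝ := fun m => ∑ j : Fin K with Fin.val j < m, p j with hq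
  have hq0 : ∀ m, 0 ≤ q m := fun m => Finset.sum_nonneg fun j _ => hp j
  have hqK : q K = ∑ i, p i := by simp [hq]
  refine (cumPower_le (q := q) (hq0 0) ?_ K le_rfl).trans (hqK.trans_le hP)
  intro i hi
  have hqm : q i ≤ q (i + 1) := by
    refine Finset.sum_le_sum_of_subset_of_nonneg ?_ fun j _ _ => hp j
    intro j
    simp only [Finset.mem_filter, Finset.mem_univ, true_and]
    omega
  have h1 := hle ⟨i, hi⟩
  rw [← rankRate_eq] at h1
  have e1 : ∑ j with j ≤ (⟨i, hi⟩ : Fin K), p j = q (i + 1) := by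
    simp [hq, Fin.le_def]
  have e2 : ∑ j with j < (⟨i, hi⟩ : Fin K), p j = q i := by
    simp only [hq, Fin.lt_def]
  rw [e1, e2] at h1
  have h1' : rankRate rk R i ≤ _ := h1
  by_cases h0 : h (rk ⟨i, hi⟩) = 0
  · simp only [h0, zero_mul, add_zero, div_one, Real.logb_one] at h1'
    rw [le_antisymm h1' (rankRate_nonneg rk hR i)]
    simpa using hqm
  · have hpos : 0 < h (rk ⟨i, hi⟩) := lt_of_le_of_ne (hh _) (Ne.symm h0)
    rw [le_logb_div_iff hpos (hq0 _) (hq0 _)] at h1'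
    simpa [rankNoise, hi, noise, h0] using h1'

lemma exists_power_of_mem_powerRegion {P : ℝ} {h : Fin K → ℝ} (hh : ∀ k, 0 ≤ h k)
    {rk : Equiv.Perm (Fin K)} {R : UserSet K → ℝ} (hR : R ∈ powerRegion P h rk) :
    ∃ p : Fin K → ℝ, (∀ i, 0 ≤ p i) ∧ ∑ i, p i ≤ P ∧ ∀ i : Fin K,
        ∑ J : UserSet K with rk i ∈ J.1 ∧ ∀ k ∈ J.1, rk.symm k ≤ i, R J ≤
          Real.logb 2 ((1 + h (rk i) * ∑ j with j ≤ i, p j) /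
            (1 + h (rk i) * ∑ j with j < i, p j)) := by
  obtain ⟨hR0, hRz, hP⟩ := powerRegion_iff.1 hR
  set q := cumPower (rankNoise h rk) (rankRate rk R) with hq
  have hmono : Monotone q :=
    cumPower_monotone (rankNoise_nonneg hh rk) (rankRate_nonneg rk hR0)
  have hq0 : q 0 = 0 := rfl
  have hqn : ∀ m, 0 ≤ q m := fun m => hq0 ▸ hmono (Nat.zero_le m)
  have hsum : ∀ m ≤ K, ∑ j : Fin K with Fin.val j < m, (q (j + 1) - q j) = q m := by
    intro m hm
    rw [Finset.sum_filter, Fin.sum_univ_eq_sum_range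
      (fun j => if j < m then q (j + 1) - q j else 0) K, ← Finset.sum_filter]
    have : (Finset.range K).filter (· < m) = Finset.range m := by
      ext j; simp; omega
    rw [this, Finset.sum_range_sub, hq0, sub_zero]
  -- The increments of the least cumulative power, which meet each constraint with equality at users
  -- of positive gain.
  refine ⟨fun j => q (j + 1) - q j, fun j => sub_nonneg.2 (hmono (Nat.le_succ _)), ?_, ?_⟩
  · have := hsum K le_rfl
    simp only [Fin.is_lt, Finset.filter_true] at this
    rw [this]; exact hP
  · intro i
    rw [← rankRate_eq]
    have e1 : ∑ j with j ≤ i, (q (j + 1) - q j) = q (i + 1) := by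
      rw [← hsum (i + 1) i.2]
      simp only [Fin.le_def, Nat.lt_succ_iff]
    have e2 : ∑ j with j < i, (q (j + 1) - q j) = q i := by
      rw [← hsum i i.2.le]
      simp only [Fin.lt_def]
    rw [e1, e2]
    by_cases h0 : h (rk i) = 0
    · simp only [h0, zero_mul, add_zero, div_one, Real.logb_one]
      refine (Finset.sum_eq_zero fun J hJ => ?_).le
      simp only [Finset.mem_filter, Finset.mem_univ, true_and, maxRank_eq_iff] at hJ
      exact hRz J _ hJ.1 h0
    · have hpos : 0 < h (rk i) := lt_of_le_of_ne (hh _) (Ne.symm h0)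
      rw [le_logb_div_iff hpos (hqn _) (hqn _)]
      have e3 : rankNoise h rk (i + 1) = (h (rk i))⁻¹ := by
        simp [rankNoise, noise, h0]
      have e4 : q (i + 1) = 2 ^ rankRate rk R i * (rankNoise h rk (i + 1) + q i) -
        rankNoise h rk (i + 1) := rfl
      rw [e4, e3]
      linarith

lemma exists_ranking (h : Fin K → ℝ) : ∃ rk : Equiv.Perm (Fin K), Antitone fun i => h (rk i) := by
  refine ⟨Tuple.sort (fun k => -h k), fun i j hij => ?_⟩
  have := Tuple.monotone_sort (fun k => -h k) hij
  simpa using this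

lemma capacityRegion_eq {P : ℝ} {h : Fin K → ℝ} (hh : ∀ k, 0 ≤ h k)
    {rk : Equiv.Perm (Fin K)} (hrk : Antitone fun i => h (rk i)) :
    capacityRegion P h = powerRegion P h rk := by
  ext R
  constructor
  · rintro ⟨hR, rk', p, hrk', hp, hP, hle⟩
    rw [powerRegion_eq hh hrk hrk']
    exact mem_powerRegion_of_power hh hrk' hR hp hP hle
  · intro hR
    obtain ⟨p, hp, hP, hle⟩ := exists_power_of_mem_powerRegion hh hR
    exact ⟨hR.1, rk, p, hrk, hp, hP, hle⟩

lemma isClosed_powerRegion (P : ℝ) (h : Fin K → ℝ) (rk : Equiv.Perm (Fin K)) :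
    IsClosed (powerRegion P h rk) := by
  have h1 : IsClosed {R : UserSet K → ℝ | ∀ J, 0 ≤ R J} := by
    simp only [Set.ofPred_forall]
    exact isClosed_iInter fun J => isClosed_le continuous_const (continuous_apply J)
  have h2 : IsClosed {R : UserSet K → ℝ | ∀ J : UserSet K, ∀ k ∈ J.1, h k = 0 → R J = 0} := by
    simp only [Set.ofPred_forall]
    exact isClosed_iInter fun J => isClosed_iInter fun k => isClosed_iInter fun _ =>
      isClosed_iInter fun _ => isClosed_eq (continuous_apply J) continuous_const
  have h3 : IsClosed {R : UserSet K → ℝ |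
      ∑ i ∈ Finset.range K, (rankNoise h rk (i + 1) - rankNoise h rk i) *
        2 ^ (∑ J : UserSet K with i ≤ maxRank rk J, R J) ≤ P + rankNoise h rk K} := by
    refine isClosed_le ?_ continuous_const
    refine continuous_finsetSum _ fun i _ => continuous_const.mul ?_
    exact (Real.continuous_const_rpow two_ne_zero).comp
      (continuous_finsetSum _ fun J _ => continuous_apply J)
  exact h1.inter (h2.inter h3)

lemma convex_powerRegion (P : ℝ) {h : Fin K → ℝ} (hh : ∀ k, 0 ≤ h k) {rk : Equiv.Perm (Fin K)}
    (hrk : Antitone fun i => h (rk i)) : Convex ℝ (powerRegion P h rk) := by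
  intro R hR R' hR' s t hs ht hst
  refine ⟨fun J => ?_, fun J k hk h0 => ?_, ?_⟩
  · exact add_nonneg (mul_nonneg hs (hR.1 J)) (mul_nonneg ht (hR'.1 J))
  · simp [hR.2.1 J k hk h0, hR'.2.1 J k hk h0]
  · have h1 := mul_le_mul_of_nonneg_left hR.2.2 hs
    have h2 := mul_le_mul_of_nonneg_left hR'.2.2 ht
    have h3 : s * (P + rankNoise h rk K) + t * (P + rankNoise h rk K) = P + rankNoise h rk K := by
      rw [← add_mul, hst, one_mul]
    refine le_trans ?_ ((add_le_add h1 h2).trans_eq h3)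
    rw [Finset.mul_sum, Finset.mul_sum, ← Finset.sum_add_distrib]
    refine Finset.sum_le_sum fun i hi => ?_
    have hd := sub_nonneg.2 (rankNoise_le_succ hh hrk (Finset.mem_range.1 hi))
    set A := ∑ J : UserSet K with i ≤ maxRank rk J, R J
    set A' := ∑ J : UserSet K with i ≤ maxRank rk J, R' J
    have hA : ∑ J : UserSet K with i ≤ maxRank rk J, (s • R + t • R') J = s * A + t * A' := by
      simp [Finset.sum_add_distrib, Finset.mul_sum, A, A']
    rw [hA]
    have hc : (2 : ℝ) ^ (s * A + t * A') ≤ s * 2 ^ A + t * 2 ^ A' := by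
      have := (convexOn_rpow_left (b := 2) two_pos).2 (Set.mem_univ A) (Set.mem_univ A') hs ht hst
      simpa using this
    have := mul_le_mul_of_nonneg_left hc hd
    linarith

lemma isClosed_capacityRegion (P : ℝ) {h : Fin K → ℝ} (hh : ∀ k, 0 ≤ h k) :
    IsClosed (capacityRegion P h) := by
  obtain ⟨rk, hrk⟩ := exists_ranking h
  rw [capacityRegion_eq hh hrk]
  exact isClosed_powerRegion P h rk

lemma convex_capacityRegion (P : ℝ) {h : Fin K → ℝ} (hh : ∀ k, 0 ≤ h k) :
    Convex ℝ (capacityRegion P h) := by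
  obtain ⟨rk, hrk⟩ := exists_ranking h
  rw [capacityRegion_eq hh hrk]
  exact convex_powerRegion P hh hrk

lemma le_of_mem_capacityRegion {P : ℝ} {h : Fin K → ℝ} (hh : ∀ k, 0 ≤ h k)
    {R : UserSet K → ℝ} (hR : R ∈ capacityRegion P h) (J : UserSet K) :
    R J ≤ Real.logb 2 (1 + (∑ k, h k) * P) := by
  obtain ⟨hR, rk, p, hrk, hp, hP, hle⟩ := hR
  set i : Fin K := ⟨maxRank rk J, maxRank_lt rk J⟩ with hi
  have h1 : R J ≤ rankRate rk R i :=
    Finset.single_le_sum (f := R) (fun J _ => hR J) (by simp [hi])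
  have h2 := hle i
  rw [← rankRate_eq] at h2
  refine (h1.trans h2).trans (Real.logb_le_logb_of_le one_lt_two ?_ ?_)
  · have ha : 0 ≤ ∑ j with j ≤ i, p j := Finset.sum_nonneg fun j _ => hp j
    have hb : 0 ≤ ∑ j with j < i, p j := Finset.sum_nonneg fun j _ => hp j
    have := hh (rk i)
    positivity
  · have hb : 0 ≤ ∑ j with j < i, p j := Finset.sum_nonneg fun j _ => hp j
    have ha : 0 ≤ ∑ j with j ≤ i, p j := Finset.sum_nonneg fun j _ => hp j
    have h0 := hh (rk i)
    refine (div_le_self (by positivity) (by nlinarith [mul_nonneg h0 hb])).trans ?_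
    have h3 : ∑ j with j ≤ i, p j ≤ P := le_trans
      (Finset.sum_le_sum_of_subset_of_nonneg (Finset.filter_subset _ _) fun j _ _ => hp j) hP
    have h4 : h (rk i) ≤ ∑ k, h k := Finset.single_le_sum (fun k _ => hh k) (Finset.mem_univ _)
    have := mul_le_mul h4 h3 ha (Finset.sum_nonneg fun k _ => hh k)
    linarith

lemma isCompact_capacityRegion (P : ℝ) {h : Fin K → ℝ} (hh : ∀ k, 0 ≤ h k) :
    IsCompact (capacityRegion P h) := by
  refine (isCompact_Icc (a := (0 : UserSet K → ℝ))
    (b := fun _ => Real.logb 2 (1 + (∑ k, h k) * P))).of_isClosed_subset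
    (isClosed_capacityRegion P hh) fun R hR => ⟨hR.1, le_of_mem_capacityRegion hh hR⟩

lemma zero_mem_capacityRegion {P : ℝ} (hP : 0 ≤ P) {h : Fin K → ℝ} (hh : ∀ k, 0 ≤ h k) :
    0 ∈ capacityRegion P h := by
  obtain ⟨rk, hrk⟩ := exists_ranking h
  rw [capacityRegion_eq hh hrk]
  refine ⟨fun _ => le_rfl, fun _ _ _ _ => rfl, ?_⟩
  simp only [Pi.zero_apply, Finset.sum_const_zero, Real.rpow_zero, mul_one, Finset.sum_range_sub]
  simp [rankNoise, hP]

lemma exists_pos_mem_capacityRegion {P : ℝ} (hP : 0 < P) {h : Fin K → ℝ} (hh : ∀ k, 0 < h k) :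
    ∃ R ∈ capacityRegion P h, ∀ J, 0 < R J := by
  have hh' : ∀ k, 0 ≤ h k := fun k => (hh k).le
  obtain ⟨rk, hrk⟩ := exists_ranking h
  rw [capacityRegion_eq hh' hrk]
  -- With equal rates `ε` for all messages the needed power is continuous in `ε`. At `ε = 0` the sum
  -- telescopes to the last noise level, which leaves all of `P` as slack.
  have hcont : Continuous fun ε : ℝ =>
      ∑ i ∈ Finset.range K, (rankNoise h rk (i + 1) - rankNoise h rk i) *
      (2 : ℝ) ^ (∑ J : UserSet K with i ≤ maxRank rk J, ε) := by
    refine continuous_finsetSum _ fun i _ => continuous_const.mul ?_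
    exact (Real.continuous_const_rpow two_ne_zero).comp
      (continuous_finsetSum _ fun J _ => continuous_id)
  have h0 : ∑ i ∈ Finset.range K, (rankNoise h rk (i + 1) - rankNoise h rk i) *
      (2 : ℝ) ^ (∑ J : UserSet K with i ≤ maxRank rk J, (0 : ℝ)) < P + rankNoise h rk K := by
    simp only [Finset.sum_const_zero, Real.rpow_zero, mul_one, Finset.sum_range_sub]
    simp [rankNoise, hP]
  have hev := (hcont.tendsto 0).eventually (gt_mem_nhds h0)
  obtain ⟨ε, hε, hpos⟩ :=
    ((hev.filter_mono nhdsWithin_le_nhds).and (self_mem_nhdsWithin (s := Set.Ioi (0 : ℝ)))).exists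
  exact ⟨fun _ => ε, ⟨fun _ => le_of_lt hpos, fun J k _ h0 => absurd h0 (hh k).ne', hε.le⟩,
    fun _ => hpos⟩

end Region

/-! ### The averaged capacity region, as a linear image of a product of compact convex sets. -/

namespace Network

variable {K : ℕ} {H : Type*} [Fintype H] (net : Network K H)

/-- The average of a family of rate vectors over the channel states. -/
noncomputable def stateAverage : (H → UserSet K → ℝ) →ₗ[ℝ] (UserSet K → ℝ) :=
  ∑ s, net.prob s • LinearMap.proj s

lemma stateAverage_apply (r : H → UserSet K → ℝ) :
    net.stateAverage r = ∑ s, net.prob s • r s := by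
  simp [stateAverage]

lemma avgCapacity_eq_image : net.avgCapacity =
    net.stateAverage '' (Set.univ.pi fun s => capacityRegion net.power (net.gain s)) := by
  ext u
  simp only [avgCapacity, Set.mem_ofPred_eq, Set.mem_image, Set.mem_univ_pi, stateAverage_apply,
    eq_comm]

lemma convex_avgCapacity : Convex ℝ net.avgCapacity := by
  rw [avgCapacity_eq_image]
  exact (convex_pi fun s _ => convex_capacityRegion _ (net.gain_nonneg s)).linear_image _

lemma isCompact_avgCapacity : IsCompact net.avgCapacity := by
  rw [avgCapacity_eq_image]
  exact (isCompact_univ_pi fun s => isCompact_capacityRegion _ (net.gain_nonneg s)).image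
    net.stateAverage.continuous_of_finiteDimensional

end Network

end CodedCaching

namespace CodedCaching

/-! ### Slack at interior points, and the region with strict inequalities. -/

namespace Network

variable {K : ℕ} {H : Type*} [Fintype H] (net : Network K H)

lemma bits_nonneg (J I : UserSet K) : 0 ≤ net.bits J I := by
  have h1 := net.fileSize_pos
  have h2 := net.memory_nonneg
  have h3 := sub_nonneg.2 net.memory_le_one
  unfold bits
  positivity

/-- A rate vector in the interior of the region leaves some slack to the user queues. -/
lemma exists_slack {a : Fin K → ℝ≥0} (ha : a ∈ interior net.region) :
    ∃ (c u : UserSet K → ℝ) (δ : ℝ), 0 < δ ∧ δ < 1 ∧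
      (∀ J, 0 ≤ c J ∧ c J ≤ net.combMax) ∧ u ∈ net.avgCapacity ∧
      (∀ k, (a k : ℝ) < (1 - δ) * ∑ J : UserSet K with k ∈ J.1, c J) ∧
      ∀ I : UserSet K, ∑ J : UserSet K with I.1 ⊆ J.1, net.bits J I * c J ≤ net.slot * u I := by
  -- Raising all rates by `t` stays in the orthant, so an interior point relative to it yields slack
  -- even where `a k = 0`.
  have hcont : Continuous fun t : ℝ≥0 => fun k => a k + t := by fun_prop
  have hev : ∀ᶠ t : ℝ≥0 in 𝓝 0, (fun k => a k + t) ∈ interior net.region := by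
    refine (hcont.tendsto 0).eventually (isOpen_interior.mem_nhds ?_)
    simpa using ha
  obtain ⟨t, ht, htpos⟩ :=
    ((hev.filter_mono nhdsWithin_le_nhds).and (self_mem_nhdsWithin (s := Set.Ioi (0 : ℝ≥0)))).exists
  obtain ⟨c, u, hc, hu, hk, hI⟩ := interior_subset ht
  have hlt : ∀ k, (a k : ℝ) < ∑ J : UserSet K with k ∈ J.1, c J := by
    intro k
    refine lt_of_lt_of_le ?_ (hk k)
    have : (0 : ℝ) < t := htpos
    push_cast
    linarith
  have hδ : ∀ᶠ δ : ℝ in 𝓝 0, ∀ k, (a k : ℝ) < (1 - δ) * ∑ J : UserSet K with k ∈ J.1, c J := by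
    refine eventually_all.2 fun k => ?_
    have hc : Continuous fun δ : ℝ => (1 - δ) * ∑ J : UserSet K with k ∈ J.1, c J := by fun_prop
    refine (hc.tendsto 0).eventually (lt_mem_nhds ?_)
    simpa using hlt k
  obtain ⟨δ, hδ, hδ0, hδ1⟩ := ((hδ.filter_mono nhdsWithin_le_nhds).and
    (Ioo_mem_nhdsGT (one_pos : (0 : ℝ) < 1))).exists
  exact ⟨c, u, δ, hδ0, hδ1, hc, hu, hδ, hI⟩

lemma isOpen_strictRegion : IsOpen net.strictRegion := by
  have h : net.strictRegion = ⋃ (c : UserSet K → ℝ) (u : UserSet K → ℝ)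
      (_ : (∀ J, 0 ≤ c J ∧ c J ≤ net.combMax) ∧ u ∈ net.avgCapacity ∧
        ∀ I : UserSet K, ∑ J : UserSet K with I.1 ⊆ J.1, net.bits J I * c J < net.slot * u I),
      {a : Fin K → ℝ≥0 | ∀ k, (a k : ℝ) < ∑ J : UserSet K with k ∈ J.1, c J} := by
    ext a
    simp only [strictRegion, Set.mem_ofPred_eq, Set.mem_iUnion, exists_prop]
    refine exists_congr fun c => exists_congr fun u => ?_
    tauto
  rw [h]
  refine isOpen_iUnion fun c => isOpen_iUnion fun u => isOpen_iUnion fun _ => ?_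
  simp only [Set.ofPred_forall]
  exact isOpen_iInter_of_finite fun k => isOpen_lt (by fun_prop) continuous_const

lemma strictRegion_subset_region : net.strictRegion ⊆ net.region := by
  rintro a ⟨c, u, hc, hu, hk, hI⟩
  exact ⟨c, u, hc, hu, fun k => (hk k).le, fun I => (hI I).le⟩

lemma exists_pos_mem_avgCapacity (h : ∃ s, 0 < net.prob s ∧ ∀ k, 0 < net.gain s k) :
    ∃ u ∈ net.avgCapacity, ∀ I, 0 < u I := by
  classical
  obtain ⟨s, hs, hg⟩ := h
  obtain ⟨R, hR, hpos⟩ := exists_pos_mem_capacityRegion net.power_pos hg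
  refine ⟨net.prob s • R, ⟨Pi.single s R, fun s' => ?_, ?_⟩, fun I => mul_pos hs (hpos I)⟩
  · by_cases hss : s' = s
    · subst hss
      simpa using hR
    · rw [Pi.single_eq_of_ne hss]
      exact zero_mem_capacityRegion net.power_pos.le (net.gain_nonneg s')
  · rw [Finset.sum_eq_single s]
    · simp
    · intro b _ hb
      simp [Pi.single_eq_of_ne hb]
    · simp

theorem interior_region_eq_strictRegion (h : ∃ s, 0 < net.prob s ∧ ∀ k, 0 < net.gain s k) :
    interior net.region = net.strictRegion := by
  refine Set.Subset.antisymm (fun a ha => ?_)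
    (interior_maximal net.strictRegion_subset_region net.isOpen_strictRegion)
  obtain ⟨c, u, δ, hδ0, hδ1, hc, hu, hk, hI⟩ := net.exists_slack ha
  obtain ⟨v, hv, hpos⟩ := net.exists_pos_mem_avgCapacity h
  have h1 : 0 < 1 - δ := by linarith
  -- The rates give up a fraction `δ` of `u` for the positive vector `v`. As `c` shrinks by the same
  -- factor, the `δ * v` part is pure surplus, also where both sides of the old inequality vanish.
  refine ⟨(1 - δ) • c, (1 - δ) • u + δ • v, fun J => ⟨?_, ?_⟩,
    net.convex_avgCapacity hu hv h1.le hδ0.le (by ring), fun k => ?_, fun I => ?_⟩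
  · exact mul_nonneg h1.le (hc J).1
  · exact (mul_le_of_le_one_left (hc J).1 (by linarith)).trans (hc J).2
  · simpa [← Finset.mul_sum] using hk k
  · have h2 := mul_le_mul_of_nonneg_left (hI I) h1.le
    have h3 : 0 < δ * (net.slot * v I) := mul_pos hδ0 (mul_pos net.slot_pos (hpos I))
    have h4 : ∑ J : UserSet K with I.1 ⊆ J.1, net.bits J I * ((1 - δ) • c) J =
        (1 - δ) * ∑ J : UserSet K with I.1 ⊆ J.1, net.bits J I * c J := by
      rw [Finset.mul_sum]
      refine Finset.sum_congr rfl fun J _ => ?_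
      simp only [Pi.smul_apply, smul_eq_mul]
      ring
    rw [h4]
    simp only [Pi.add_apply, Pi.smul_apply, smul_eq_mul]
    linarith

end Network

end CodedCaching

namespace CodedCaching

/-! ### Necessity: sublinear queues and flow balance. -/

section Queues

variable {Ω : Type*} [MeasurableSpace Ω] {law : Measure Ω}

/-- A strongly stable queue with bounded departures has sublinear expected length. -/
lemma StronglyStable.tendsto_div [IsProbabilityMeasure law] {X : ℕ → Ω → ℝ}
    (hX : StronglyStable law X) {C : ℝ} (hC : 0 ≤ C) (h : ∀ t ω, X t ω ≤ X (t + 1) ω + C) :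
    Tendsto (fun T : ℕ => (∫⁻ ω, ENNReal.ofReal (X T ω) ∂law) / (T : ℝ≥0∞)) atTop (𝓝 0) := by
  set e : ℕ → ℝ≥0∞ := fun t => ∫⁻ ω, ENNReal.ofReal (X t ω) ∂law
  have hstep : ∀ t, e t ≤ e (t + 1) + ENNReal.ofReal C := by
    intro t
    have h1 : e t ≤ ∫⁻ ω, (ENNReal.ofReal (X (t + 1) ω) + ENNReal.ofReal C) ∂law :=
      lintegral_mono fun ω =>
        (ENNReal.ofReal_le_ofReal (h t ω)).trans ENNReal.ofReal_add_le
    rwa [lintegral_add_right _ measurable_const, lintegral_const, measure_univ, mul_one] at h1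
  have hsteps : ∀ s T, e T ≤ e (T + s) + s * ENNReal.ofReal C := by
    intro s
    induction s with
    | zero => intro T; simp
    | succ s ih =>
      intro T
      refine ((ih T).trans (add_le_add_left (hstep (T + s)) _)).trans_eq ?_
      push_cast
      rw [← add_assoc T s 1]
      ring
  obtain ⟨M, hM1, hM2⟩ := ENNReal.lt_iff_exists_nnreal_btwn.1 hX
  have hev : ∀ᶠ T : ℕ in atTop, ∑ t ∈ Finset.range T, e t ≤ M * T := by
    filter_upwards [eventually_lt_of_limsup_lt hM1, eventually_gt_atTop 0] with T hT hpos
    have h1 : (∑ t ∈ Finset.range T, e t) / (T : ℝ≥0∞) ≤ M := hT.le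
    rwa [ENNReal.div_le_iff (by exact_mod_cast hpos.ne') (by simp)] at h1
  obtain ⟨T₀, hT₀⟩ := eventually_atTop.1 hev
  -- A queue that is long at time `T` stays long for `m` slots, as it loses at most `C` per slot;
  -- but the sum over `T + m` slots is at most `M * (T + m)`. Hence `e T ≤ M * (T + m) / m + m * C`,
  -- and `m` of order `√T` makes this `O(√T)`.
  have hmain : ∀ T m : ℕ, T₀ ≤ T →
      (m : ℝ≥0∞) * e T ≤ M * ((T + m : ℕ) : ℝ≥0∞) + m * (m * ENNReal.ofReal C) := by
    intro T m hT
    calc (m : ℝ≥0∞) * e T = ∑ s ∈ Finset.range m, e T := by simp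
      _ ≤ ∑ s ∈ Finset.range m, (e (T + s) + m * ENNReal.ofReal C) := by
        refine Finset.sum_le_sum fun s hs => (hsteps s T).trans ?_
        have : s ≤ m := (Finset.mem_range.1 hs).le
        gcongr
      _ = ∑ s ∈ Finset.range m, e (T + s) + m * (m * ENNReal.ofReal C) := by
        rw [Finset.sum_add_distrib]; simp
      _ ≤ ∑ t ∈ Finset.range (T + m), e t + m * (m * ENNReal.ofReal C) := by
        gcongr
        rw [Finset.sum_range_add]
        exact le_add_self
      _ ≤ _ := by
        gcongr
        exact hT₀ _ (by omega)
  have hbound : ∀ᶠ T : ℕ in atTop,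
      e T / (T : ℝ≥0∞) ≤ ENNReal.ofReal ((3 * M + 2 * C) / √T) := by
    filter_upwards [eventually_ge_atTop T₀, eventually_ge_atTop 1] with T hT hT1
    set m := Nat.sqrt T + 1 with hm
    have hTr : (1 : ℝ) ≤ T := by exact_mod_cast hT1
    have hs1 : 1 ≤ √(T : ℝ) := Real.one_le_sqrt.2 hTr
    have hsq : √(T : ℝ) * √T = T := Real.mul_self_sqrt (by positivity)
    have hm1 : √(T : ℝ) ≤ m := by
      rw [Real.sqrt_le_left (by positivity), hm]
      exact_mod_cast (Nat.lt_succ_sqrt' T).le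
    have hm2 : (m : ℝ) ≤ 2 * √T := by
      have : (Nat.sqrt T : ℝ) ≤ √T := Real.nat_sqrt_le_real_sqrt
      rw [hm]; push_cast; linarith
    have hmpos : (0 : ℝ) < m := by rw [hm]; positivity
    have h1 := hmain T m hT
    have hfin : e T ≠ ⊤ := by
      intro htop
      rw [htop, ENNReal.mul_top (by rw [hm]; positivity)] at h1
      refine absurd h1 (not_le.2 ?_)
      exact ENNReal.add_lt_top.2 ⟨ENNReal.mul_lt_top ENNReal.coe_lt_top (by simp),
        ENNReal.mul_lt_top (by simp) (ENNReal.mul_lt_top (by simp) ENNReal.ofReal_lt_top)⟩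
    have h2 : (m : ℝ) * (e T).toReal ≤ M * ((T + m : ℕ) : ℝ) + m * (m * C) := by
      have h3 := ENNReal.toReal_mono (by finiteness) h1
      rw [ENNReal.toReal_mul, ENNReal.toReal_add (by finiteness) (by finiteness)] at h3
      simpa [-Nat.cast_add, ENNReal.toReal_mul, ENNReal.toReal_ofReal hC] using h3
    have h4 : (e T).toReal ≤ T * ((3 * M + 2 * C) / √T) := by
      have hMn : (0 : ℝ) ≤ M := M.2
      have h5 : √(T : ℝ) * (e T).toReal ≤ M * (3 * T) + (2 * √T) * (√T * C) := by
        have hs : (m : ℝ) * (e T).toReal ≤ M * (T + m) + m * (m * C) := by exact_mod_cast h2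
        have h6 : (e T).toReal ≤ M * (T + m) / m + m * C := by
          rw [← mul_le_mul_iff_right₀ hmpos]
          refine hs.trans_eq ?_
          field_simp
        have h7 : M * (T + m) / m ≤ M * (3 * T) / √T := by
          have : (T : ℝ) + m ≤ 3 * T := by nlinarith
          gcongr
        have h8 : (m : ℝ) * C ≤ 2 * √T * C := by gcongr
        have h9 := mul_le_mul_of_nonneg_left (h6.trans (add_le_add h7 h8))
          (Real.sqrt_nonneg (T : ℝ))
        refine h9.trans_eq ?_
        have : √(T : ℝ) ≠ 0 := by positivity
        field_simp
      have hpos : 0 < √(T : ℝ) := by positivity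
      rw [← mul_le_mul_iff_right₀ hpos]
      refine h5.trans_eq ?_
      have e1 : √(T : ℝ) * (T * ((3 * M + 2 * C) / √T)) = T * (3 * M + 2 * C) := by
        field_simp
      rw [e1]
      linear_combination (2 * C) * hsq
    rw [ENNReal.div_le_iff (by positivity) (by simp), ← ENNReal.ofReal_natCast,
      ← ENNReal.ofReal_mul (by positivity), ← ENNReal.ofReal_toReal hfin, mul_comm _ (T : ℝ)]
    exact ENNReal.ofReal_le_ofReal h4
  refine tendsto_of_tendsto_of_tendsto_of_le_of_le' tendsto_const_nhds ?_
    (Eventually.of_forall fun _ => zero_le) hbound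
  have h1 : Tendsto (fun T : ℕ => (3 * M + 2 * C) / √(T : ℝ)) atTop (𝓝 0) :=
    tendsto_const_nhds.div_atTop (Real.tendsto_sqrt_atTop.comp tendsto_natCast_atTop_atTop)
  simpa using ENNReal.tendsto_ofReal h1

lemma timeAverage_eq_ofReal [IsProbabilityMeasure law] {D : ℕ → Ω → ℝ}
    (hD : ∀ t, Integrable (D t) law) (h0 : ∀ t ω, 0 ≤ D t ω) (T : ℕ) :
    timeAverage law D T = ENNReal.ofReal ((T : ℝ)⁻¹ * ∑ t ∈ Finset.range T, ∫ ω, D t ω ∂law) := by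
  have hi : ∀ t, 0 ≤ ∫ ω, D t ω ∂law := fun t => integral_nonneg (h0 t)
  rcases T.eq_zero_or_pos with rfl | hT
  · simp [timeAverage]
  · have h1 : ∀ t, ∫⁻ ω, ENNReal.ofReal (D t ω) ∂law = ENNReal.ofReal (∫ ω, D t ω ∂law) := fun t =>
      (ofReal_integral_eq_lintegral_ofReal (hD t) (ae_of_all _ (h0 t))).symm
    simp only [timeAverage, h1]
    rw [← ENNReal.ofReal_sum_of_nonneg fun t _ => hi t, ← ENNReal.ofReal_natCast,
      ← ENNReal.ofReal_div_of_pos (by exact_mod_cast hT), div_eq_inv_mul]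

/-- What arrives is either still in the queue or has departed. -/
lemma timeAverage_le_add {X A D : ℕ → Ω → ℝ} (hA : ∀ t, Measurable (A t))
    (hD : ∀ t, Measurable (D t)) (hA0 : ∀ t ω, 0 ≤ A t ω) (hD0 : ∀ t ω, 0 ≤ D t ω) {T : ℕ}
    (h : ∀ ω, ∑ t ∈ Finset.range T, A t ω ≤ X T ω + ∑ t ∈ Finset.range T, D t ω) :
    timeAverage law A T ≤
      (∫⁻ ω, ENNReal.ofReal (X T ω) ∂law) / (T : ℝ≥0∞) + timeAverage law D T := by
  unfold timeAverage
  rw [← ENNReal.add_div, ← lintegral_finsetSum _ fun t _ => (hA t).ennreal_ofReal,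
    ← lintegral_finsetSum _ fun t _ => (hD t).ennreal_ofReal,
    ← lintegral_add_right _ (Finset.measurable_sum _ fun t _ => (hD t).ennreal_ofReal)]
  refine ENNReal.div_le_div_right (lintegral_mono fun ω => ?_) _
  dsimp only
  rw [← ENNReal.ofReal_sum_of_nonneg fun t _ => hA0 t ω,
    ← ENNReal.ofReal_sum_of_nonneg fun t _ => hD0 t ω]
  exact (ENNReal.ofReal_le_ofReal (h ω)).trans ENNReal.ofReal_add_le

end Queues

lemma average_mem {E : Type*} [AddCommGroup E] [Module ℝ E] {s : Set E} (hs : Convex ℝ s)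
    (h0 : 0 ∈ s) {x : ℕ → E} (hx : ∀ t, x t ∈ s) (T : ℕ) :
    (T : ℝ)⁻¹ • ∑ t ∈ Finset.range T, x t ∈ s := by
  rcases T.eq_zero_or_pos with rfl | hT
  · simpa using h0
  · rw [Finset.smul_sum]
    refine hs.sum_mem (fun _ _ => by positivity) ?_ fun t _ => hx t
    have : (T : ℝ) ≠ 0 := by exact_mod_cast hT.ne'
    simp [this]

lemma sum_le_add_sum_of_step {X A D : ℕ → ℝ} (h0 : 0 ≤ X 0)
    (h : ∀ t, X t + A t ≤ X (t + 1) + D t) (T : ℕ) :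
    ∑ t ∈ Finset.range T, A t ≤ X T + ∑ t ∈ Finset.range T, D t := by
  induction T with
  | zero => simpa using h0
  | succ T ih =>
    rw [Finset.sum_range_succ, Finset.sum_range_succ]
    have := h T
    linarith

namespace Network

variable {K : ℕ} {H : Type*} [Fintype H] {net : Network K H}

variable (net) in
lemma exists_rate_bound : ∃ L : ℝ, 0 ≤ L ∧
    ∀ s, ∀ R ∈ capacityRegion net.power (net.gain s), ∀ J, R J ≤ L := by
  have h0 : ∀ s, 0 ≤ Real.logb 2 (1 + (∑ k, net.gain s k) * net.power) := fun s =>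
    Real.logb_nonneg one_lt_two (le_add_of_nonneg_right
      (mul_nonneg (Finset.sum_nonneg fun k _ => net.gain_nonneg s k) net.power_pos.le))
  refine ⟨∑ s, Real.logb 2 (1 + (∑ k, net.gain s k) * net.power),
    Finset.sum_nonneg fun s _ => h0 s, fun s R hR J => ?_⟩
  exact (le_of_mem_capacityRegion (net.gain_nonneg s) hR J).trans
    (Finset.single_le_sum (fun s _ => h0 s) (Finset.mem_univ s))

variable (net) in
lemma zero_mem_avgCapacity : 0 ∈ net.avgCapacity :=
  ⟨0, fun s => zero_mem_capacityRegion net.power_pos.le (net.gain_nonneg s), by simp⟩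

namespace ControlledSystem

variable (sys : net.ControlledSystem)

lemma measurable_admitted (t : ℕ) (k : Fin K) : Measurable fun ω => (sys.admitted t k ω : ℝ) :=
  measurable_from_top.comp ((sys.admitted_measurable t k).mono (sys.info.le t) le_rfl)

lemma measurable_comb (t : ℕ) (J : UserSet K) : Measurable fun ω => (sys.comb t J ω : ℝ) :=
  measurable_from_top.comp ((sys.comb_measurable t J).mono (sys.info.le t) le_rfl)

lemma measurable_rate (t : ℕ) (I : UserSet K) : Measurable (sys.rate t I) :=
  (sys.rate_measurable t I).mono (sys.info.le t) le_rfl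

lemma rate_nonneg (t : ℕ) (I : UserSet K) (ω : sys.Ω) : 0 ≤ sys.rate t I ω :=
  (sys.rate_mem t ω).1 I

lemma integrable_comb (t : ℕ) (J : UserSet K) :
    Integrable (fun ω => (sys.comb t J ω : ℝ)) sys.law := by
  refine Integrable.of_bound (sys.measurable_comb t J).aestronglyMeasurable net.combMax
    (ae_of_all _ fun ω => ?_)
  simpa using sys.comb_le t J ω

lemma integrable_rate (t : ℕ) (I : UserSet K) : Integrable (sys.rate t I) sys.law := by
  obtain ⟨L, -, hL⟩ := net.exists_rate_bound
  refine Integrable.of_bound (sys.measurable_rate t I).aestronglyMeasurable L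
    (ae_of_all _ fun ω => ?_)
  rw [Real.norm_of_nonneg (sys.rate_nonneg t I ω)]
  exact hL _ _ (sys.rate_mem t ω) I

lemma measurableSet_channel (t : ℕ) (s : H) : MeasurableSet {ω | sys.channel t ω = s} :=
  sys.info.le t _ (sys.channel_measurable t (show MeasurableSet[⊤] {s} from trivial))

/-- The expected rate vector of a slot lies in the average capacity region. -/
lemma integral_rate_mem (t : ℕ) :
    (fun I => ∫ ω, sys.rate t I ω ∂sys.law) ∈ net.avgCapacity := by
  set f : sys.Ω → UserSet K → ℝ := fun ω I => sys.rate t I ω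
  have hfi : Integrable f sys.law := Integrable.of_eval fun I => sys.integrable_rate t I
  have hint : (fun I => ∫ ω, sys.rate t I ω ∂sys.law) = ∫ ω, f ω ∂sys.law := by
    funext I
    exact (eval_integral (fun I => sys.integrable_rate t I) I).symm
  rw [hint]
  -- The witness is the conditional mean of the rates given state `s`, which lies in the closed
  -- convex set `capacityRegion`. For a null state the conditional measure is zero, and so is the
  -- mean.
  refine ⟨fun s => ∫ ω, f ω ∂(sys.law[|{ω | sys.channel t ω = s}]), fun s => ?_, ?_⟩
  · by_cases hs : sys.law {ω | sys.channel t ω = s} = 0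
    · have : sys.law[|{ω | sys.channel t ω = s}] = 0 := cond_eq_zero_of_meas_eq_zero hs
      simp only [this, integral_zero_measure]
      exact zero_mem_capacityRegion net.power_pos.le (net.gain_nonneg s)
    · have := cond_isProbabilityMeasure (μ := sys.law) hs
      refine (convex_capacityRegion _ (net.gain_nonneg s)).integral_mem
        (isClosed_capacityRegion _ (net.gain_nonneg s)) ?_ ?_
      · filter_upwards [ae_cond_mem (μ := sys.law) (sys.measurableSet_channel t s)] with ω hω
        have h1 : sys.channel t ω = s := hω
        rw [← h1]
        exact sys.rate_mem t ω
      · exact hfi.restrict.smul_measure (ENNReal.inv_ne_top.2 hs)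
  · have huniv : ⋃ s, {ω | sys.channel t ω = s} = Set.univ := by
      ext ω; simp
    have h1 := integral_iUnion_fintype (f := f) (μ := sys.law) (sys.measurableSet_channel t)
      (fun s s' hss => Set.disjoint_left.2 fun ω h h' => hss (Eq.trans (Eq.symm h) h'))
      (fun s => hfi.integrableOn)
    rw [huniv, setIntegral_univ] at h1
    rw [h1]
    refine Finset.sum_congr rfl fun s _ => ?_
    have hp : (sys.law {ω | sys.channel t ω = s}).toReal = net.prob s := by
      rw [sys.channel_law, ENNReal.toReal_ofReal (net.prob_nonneg s)]
    have hcond : sys.law[|{ω | sys.channel t ω = s}] = (sys.law {ω | sys.channel t ω = s})⁻¹ •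
        sys.law.restrict {ω | sys.channel t ω = s} := rfl
    simp only [hcond]
    rw [integral_smul_measure, ENNReal.toReal_inv, hp, smul_smul]
    by_cases hs : net.prob s = 0
    · have : sys.law {ω | sys.channel t ω = s} = 0 := by rw [sys.channel_law, hs]; simp
      rw [hs, zero_mul, zero_smul, Measure.restrict_eq_zero.2 this, integral_zero_measure]
    · rw [mul_inv_cancel₀ hs, one_smul]

lemma userQueue_le (k : Fin K) (t : ℕ) (ω : sys.Ω) :
    sys.userQueue k t ω + sys.admitted t k ω ≤
      sys.userQueue k (t + 1) ω + ∑ J : UserSet K with k ∈ J.1, (sys.comb t J ω : ℝ) := by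
  have := le_max_left (sys.userQueue k t ω - ∑ J : UserSet K with k ∈ J.1, (sys.comb t J ω : ℝ)) 0
  simp only [userQueue]
  linarith

lemma codeQueue_le (I : UserSet K) (t : ℕ) (ω : sys.Ω) :
    sys.codeQueue I t ω + ∑ J : UserSet K with I.1 ⊆ J.1, net.bits J I * (sys.comb t J ω : ℝ) ≤
      sys.codeQueue I (t + 1) ω + net.slot * sys.rate t I ω := by
  have := le_max_left (sys.codeQueue I t ω - net.slot * sys.rate t I ω) 0
  simp only [codeQueue]
  linarith

/-- The expected number of combinations of each kind in a slot. -/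
noncomputable def meanComb (t : ℕ) (J : UserSet K) : ℝ := ∫ ω, (sys.comb t J ω : ℝ) ∂sys.law

/-- The expected rates in a slot. -/
noncomputable def meanRate (t : ℕ) (I : UserSet K) : ℝ := ∫ ω, sys.rate t I ω ∂sys.law

/-- Flow balance of the user queue in the mean. It is stated in `ℝ≥0∞` because admissions need not
be integrable. -/
lemma admissionAverage_le (k : Fin K) (T : ℕ) : sys.admissionAverage k T ≤
    (∫⁻ ω, ENNReal.ofReal (sys.userQueue k T ω) ∂sys.law) / (T : ℝ≥0∞) +
      ENNReal.ofReal (∑ J : UserSet K with k ∈ J.1,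
        ((T : ℝ)⁻¹ • ∑ t ∈ Finset.range T, sys.meanComb t) J) := by
  have hpath : ∀ ω, ∑ t ∈ Finset.range T, (sys.admitted t k ω : ℝ) ≤ sys.userQueue k T ω +
      ∑ t ∈ Finset.range T, ∑ J : UserSet K with k ∈ J.1, (sys.comb t J ω : ℝ) := by
    intro ω
    have h0 : 0 ≤ sys.userQueue k 0 ω := by simp [userQueue]
    have hstep : ∀ t, sys.userQueue k t ω + (sys.admitted t k ω : ℝ) ≤
        sys.userQueue k (t + 1) ω + ∑ J : UserSet K with k ∈ J.1, (sys.comb t J ω : ℝ) :=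
      fun t => sys.userQueue_le k t ω
    have hsum := sum_le_add_sum_of_step (X := fun t => sys.userQueue k t ω)
      (A := fun t => (sys.admitted t k ω : ℝ))
      (D := fun t => ∑ J : UserSet K with k ∈ J.1, (sys.comb t J ω : ℝ)) h0 hstep T
    exact hsum
  have hD : ∀ t, Integrable (fun ω => ∑ J : UserSet K with k ∈ J.1, (sys.comb t J ω : ℝ))
      sys.law := fun t => integrable_finsetSum _ fun J _ => sys.integrable_comb t J
  have hD0 : ∀ t (ω : sys.Ω), 0 ≤ ∑ J : UserSet K with k ∈ J.1, (sys.comb t J ω : ℝ) :=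
    fun t ω => Finset.sum_nonneg fun _ _ => Nat.cast_nonneg _
  have hDm : ∀ t, Measurable fun ω => ∑ J : UserSet K with k ∈ J.1, (sys.comb t J ω : ℝ) :=
    fun t => Finset.measurable_fun_sum _ fun J _ => sys.measurable_comb t J
  have h1 := timeAverage_le_add (law := sys.law) (fun t => sys.measurable_admitted t k)
    hDm (fun t ω => Nat.cast_nonneg _) hD0 hpath
  rw [timeAverage_eq_ofReal hD hD0] at h1
  have h2 : (T : ℝ)⁻¹ * ∑ t ∈ Finset.range T,
      ∫ ω, ∑ J : UserSet K with k ∈ J.1, (sys.comb t J ω : ℝ) ∂sys.law =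
      ∑ J : UserSet K with k ∈ J.1, ((T : ℝ)⁻¹ • ∑ t ∈ Finset.range T, sys.meanComb t) J := by
    simp only [Pi.smul_apply, Finset.sum_apply, smul_eq_mul, meanComb]
    rw [← Finset.mul_sum, Finset.sum_comm]
    congr 1
    exact Finset.sum_congr rfl fun t _ => integral_finsetSum _ fun J _ => sys.integrable_comb t J
  rw [h2] at h1
  exact h1

lemma sum_bits_mul_le (I : UserSet K) (T : ℕ) :
    ENNReal.ofReal (∑ J : UserSet K with I.1 ⊆ J.1, net.bits J I *
        ((T : ℝ)⁻¹ • ∑ t ∈ Finset.range T, sys.meanComb t) J) ≤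
      (∫⁻ ω, ENNReal.ofReal (sys.codeQueue I T ω) ∂sys.law) / (T : ℝ≥0∞) +
        ENNReal.ofReal (net.slot * ((T : ℝ)⁻¹ • ∑ t ∈ Finset.range T, sys.meanRate t) I) := by
  have hpath : ∀ ω, ∑ t ∈ Finset.range T,
      ∑ J : UserSet K with I.1 ⊆ J.1, net.bits J I * (sys.comb t J ω : ℝ) ≤
      sys.codeQueue I T ω + ∑ t ∈ Finset.range T, net.slot * sys.rate t I ω := by
    intro ω
    have h0 : 0 ≤ sys.codeQueue I 0 ω := (net.codeInit I).2
    exact sum_le_add_sum_of_step (X := fun t => sys.codeQueue I t ω)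
      (A := fun t => ∑ J : UserSet K with I.1 ⊆ J.1, net.bits J I * (sys.comb t J ω : ℝ))
      (D := fun t => net.slot * sys.rate t I ω)
      h0 (fun t => sys.codeQueue_le I t ω) T
  have h1 := timeAverage_le_add (law := sys.law) (X := sys.codeQueue I) (T := T)
    (A := fun t ω => ∑ J : UserSet K with I.1 ⊆ J.1, net.bits J I * (sys.comb t J ω : ℝ))
    (D := fun t ω => net.slot * sys.rate t I ω)
    (fun t => Finset.measurable_fun_sum _ fun J _ => (sys.measurable_comb t J).const_mul _)
    (fun t => (sys.measurable_rate t I).const_mul _)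
    (fun t ω => Finset.sum_nonneg fun J _ =>
      mul_nonneg (net.bits_nonneg J I) (Nat.cast_nonneg _))
    (fun t ω => mul_nonneg net.slot_pos.le (sys.rate_nonneg t I ω)) hpath
  refine (le_of_eq ?_).trans (h1.trans (add_le_add_right (le_of_eq ?_) _))
  · rw [timeAverage_eq_ofReal
      (fun t => integrable_finsetSum _ fun J _ => (sys.integrable_comb t J).const_mul _)
      (fun t ω => Finset.sum_nonneg fun J _ =>
        mul_nonneg (net.bits_nonneg J I) (Nat.cast_nonneg _))]
    congr 1
    simp only [Pi.smul_apply, Finset.sum_apply, smul_eq_mul]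
    have h2 : ∀ t, ∫ ω, ∑ J : UserSet K with I.1 ⊆ J.1,
        net.bits J I * (sys.comb t J ω : ℝ) ∂sys.law =
        ∑ J : UserSet K with I.1 ⊆ J.1, net.bits J I * sys.meanComb t J := by
      intro t
      rw [integral_finsetSum _ fun J _ => (sys.integrable_comb t J).const_mul _]
      simp only [integral_const_mul, meanComb]
    simp only [h2]
    rw [Finset.sum_comm, Finset.mul_sum]
    refine Finset.sum_congr rfl fun J _ => ?_
    rw [← Finset.mul_sum]
    ring
  · rw [timeAverage_eq_ofReal (fun t => (sys.integrable_rate t I).const_mul _)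
      (fun t ω => mul_nonneg net.slot_pos.le (sys.rate_nonneg t I ω))]
    congr 1
    simp only [Pi.smul_apply, Finset.sum_apply, smul_eq_mul, integral_const_mul, meanRate]
    rw [← Finset.mul_sum]
    ring

lemma meanComb_mem (t : ℕ) :
    sys.meanComb t ∈ Set.Icc (0 : UserSet K → ℝ) (fun _ => (net.combMax : ℝ)) := by
  refine ⟨fun J => integral_nonneg fun ω => Nat.cast_nonneg _, fun J => ?_⟩
  have h1 : ∫ ω, (sys.comb t J ω : ℝ) ∂sys.law ≤ ∫ _, (net.combMax : ℝ) ∂sys.law :=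
    integral_mono (sys.integrable_comb t J) (integrable_const _)
      fun ω => Nat.cast_le.2 (sys.comb_le t J ω)
  rw [integral_const, probReal_univ, one_smul] at h1
  exact h1

end ControlledSystem

theorem stabilityRegion_subset_region : net.stabilityRegion ⊆ net.region := by
  rintro a ⟨sys, ⟨-, n, hn, ha⟩, hstabU, hstabC⟩
  obtain ⟨L, hL0, hL⟩ := net.exists_rate_bound
  set cA : ℕ → UserSet K → ℝ := fun T => (T : ℝ)⁻¹ • ∑ t ∈ Finset.range T, sys.meanComb t
  set uA : ℕ → UserSet K → ℝ := fun T => (T : ℝ)⁻¹ • ∑ t ∈ Finset.range T, sys.meanRate t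
  have hmax : (0 : UserSet K → ℝ) ≤ fun _ => (net.combMax : ℝ) := by
    intro J
    exact Nat.cast_nonneg _
  have hpair : ∀ i, (cA (n i), uA (n i)) ∈
      Set.Icc (0 : UserSet K → ℝ) (fun _ => (net.combMax : ℝ)) ×ˢ net.avgCapacity := fun i =>
    ⟨average_mem (convex_Icc _ _) ⟨le_rfl, hmax⟩ sys.meanComb_mem _,
      average_mem net.convex_avgCapacity net.zero_mem_avgCapacity sys.integral_rate_mem _⟩
  -- All users share the times `n`, so a single limit point `(c', u')` serves all the constraints at
  -- once.
  obtain ⟨⟨c', u'⟩, ⟨hc', hu'⟩, φ, hφ, hlim⟩ :=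
    (isCompact_Icc.prod net.isCompact_avgCapacity).tendsto_subseq hpair
  have hnφ : Tendsto (fun i => n (φ i)) atTop atTop := hn.comp hφ.tendsto_atTop
  have hclim : ∀ J, Tendsto (fun i => cA (n (φ i)) J) atTop (𝓝 (c' J)) := fun J =>
    ((continuous_apply J).tendsto _).comp ((continuous_fst.tendsto _).comp hlim)
  have hulim : ∀ I, Tendsto (fun i => uA (n (φ i)) I) atTop (𝓝 (u' I)) := fun I =>
    ((continuous_apply I).tendsto _).comp ((continuous_snd.tendsto _).comp hlim)
  refine ⟨c', u', fun J => ⟨hc'.1 J, hc'.2 J⟩, hu', fun k => ?_, fun I => ?_⟩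
  · have hS := (hstabU k).tendsto_div (C := ∑ J : UserSet K with k ∈ J.1, (net.combMax : ℝ))
      (Finset.sum_nonneg fun _ _ => Nat.cast_nonneg _) (fun t ω => by
        have h1 := sys.userQueue_le k t ω
        have h2 : ∑ J : UserSet K with k ∈ J.1, (sys.comb t J ω : ℝ) ≤
            ∑ J : UserSet K with k ∈ J.1, (net.combMax : ℝ) :=
          Finset.sum_le_sum fun J _ => by exact_mod_cast sys.comb_le t J ω
        have h3 : (0 : ℝ) ≤ sys.admitted t k ω := Nat.cast_nonneg _
        linarith)
    have h1 : Tendsto (fun i => sys.admissionAverage k (n (φ i))) atTop (𝓝 (a k : ℝ≥0∞)) :=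
      (ha k).comp hφ.tendsto_atTop
    have h2 := (hS.comp hnφ).add (ENNReal.tendsto_ofReal
      (tendsto_finsetSum (Finset.univ.filter fun J : UserSet K => k ∈ J.1) fun J _ => hclim J))
    have h3 := le_of_tendsto_of_tendsto' h1 h2 fun i => sys.admissionAverage_le k (n (φ i))
    rw [zero_add] at h3
    have h4 : 0 ≤ ∑ J : UserSet K with k ∈ J.1, c' J := Finset.sum_nonneg fun J _ => hc'.1 J
    rw [← ENNReal.ofReal_coe_nnreal] at h3
    exact (ENNReal.ofReal_le_ofReal_iff h4).1 h3
  · have hQ := (hstabC I).tendsto_div (C := net.slot * L) (mul_nonneg net.slot_pos.le hL0)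
      (fun t ω => by
        have h1 := sys.codeQueue_le I t ω
        have h2 := mul_le_mul_of_nonneg_left (hL _ _ (sys.rate_mem t ω) I) net.slot_pos.le
        have h3 : 0 ≤ ∑ J : UserSet K with I.1 ⊆ J.1, net.bits J I * (sys.comb t J ω : ℝ) :=
          Finset.sum_nonneg fun J _ => mul_nonneg (net.bits_nonneg J I) (Nat.cast_nonneg _)
        linarith)
    have h1 := ENNReal.tendsto_ofReal
      (tendsto_finsetSum (Finset.univ.filter fun J : UserSet K => I.1 ⊆ J.1)
        fun J _ => (hclim J).const_mul (net.bits J I))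
    have h2 := (hQ.comp hnφ).add (ENNReal.tendsto_ofReal ((hulim I).const_mul net.slot))
    have h3 := le_of_tendsto_of_tendsto' h1 h2 fun i => sys.sum_bits_mul_le I (n (φ i))
    rw [zero_add] at h3
    obtain ⟨r, hr, hur⟩ := hu'
    have hu0 : 0 ≤ u' I := by
      have hur : u' = ∑ s, net.prob s • r s := hur
      rw [hur]
      simp only [Finset.sum_apply, Pi.smul_apply, smul_eq_mul]
      exact Finset.sum_nonneg fun s _ => mul_nonneg (net.prob_nonneg s) ((hr s).1 I)
    exact (ENNReal.ofReal_le_ofReal_iff (mul_nonneg net.slot_pos.le hu0)).1 h3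

end Network

end CodedCaching

/-! ### Sufficiency: regular integer sequences and queue bounds. -/

namespace CodedCaching

/-- The increments of `⌊t * x⌋₊`: an integer sequence with average `x`. -/
noncomputable def floorIncrement (x : ℝ) (t : ℕ) : ℕ := ⌊((t + 1 : ℕ) : ℝ) * x⌋₊ - ⌊(t : ℝ) * x⌋₊

/-- The deviation of the sums of `floorIncrement x` from linear growth. -/
noncomputable def floorDeviation (x : ℝ) (t : ℕ) : ℝ := ⌊(t : ℝ) * x⌋₊ - t * x

lemma floorDeviation_nonpos {x : ℝ} (hx : 0 ≤ x) (t : ℕ) : floorDeviation x t ≤ 0 :=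
  sub_nonpos.2 (Nat.floor_le (by positivity))

lemma neg_one_le_floorDeviation (x : ℝ) (t : ℕ) : -1 ≤ floorDeviation x t := by
  have := Nat.lt_floor_add_one ((t : ℝ) * x)
  unfold floorDeviation
  linarith

/-- The fluctuation around `x` is the increment of a function with values in `[-1, 0]`, so a
potential function can absorb it. -/
lemma floorIncrement_eq {x : ℝ} (hx : 0 ≤ x) (t : ℕ) :
    (floorIncrement x t : ℝ) = x + floorDeviation x (t + 1) - floorDeviation x t := by
  have h : ⌊(t : ℝ) * x⌋₊ ≤ ⌊((t + 1 : ℕ) : ℝ) * x⌋₊ := by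
    gcongr
    exact t.le_succ
  rw [floorIncrement, Nat.cast_sub h]
  unfold floorDeviation
  push_cast
  ring

lemma floorIncrement_le {x : ℝ} {n : ℕ} (hx : 0 ≤ x) (hn : x ≤ n) (t : ℕ) :
    floorIncrement x t ≤ n := by
  rw [floorIncrement, Nat.sub_le_iff_le_add', ← Nat.floor_add_natCast (by positivity)]
  apply Nat.floor_mono
  push_cast
  linarith

lemma floorIncrement_zero (t : ℕ) : floorIncrement 0 t = 0 := by simp [floorIncrement]

lemma sum_floorIncrement {x : ℝ} (hx : 0 ≤ x) (T : ℕ) :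
    ∑ t ∈ Finset.range T, (floorIncrement x t : ℝ) = ⌊x * T⌋₊ := by
  induction T with
  | zero => simp
  | succ T ih =>
    rw [Finset.sum_range_succ, ih, floorIncrement_eq hx]
    unfold floorDeviation
    rw [mul_comm x, mul_comm x]
    push_cast
    ring

section Queues

variable {Ω : Type*} [MeasurableSpace Ω] {law : Measure Ω}

lemma stronglyStable_of_le {X : ℕ → Ω → ℝ} {M : ℝ≥0∞} (hM : M ≠ ⊤)
    (h : ∀ T, 0 < T → timeAverage law X T ≤ M) : StronglyStable law X := by
  refine lt_of_le_of_lt (limsup_le_of_le (h := ?_)) hM.lt_top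
  filter_upwards [eventually_gt_atTop 0] with T hT using h T hT

lemma stronglyStable_of_bounded [IsProbabilityMeasure law] {X : ℕ → Ω → ℝ} {M : ℝ} (h : ∀ t ω, X t ω ≤ M) :
    StronglyStable law X := by
  refine stronglyStable_of_le (M := ENNReal.ofReal M) ENNReal.ofReal_ne_top fun T hT => ?_
  rw [timeAverage, ENNReal.div_le_iff (by exact_mod_cast hT.ne') (by simp)]
  calc ∑ t ∈ Finset.range T, ∫⁻ ω, ENNReal.ofReal (X t ω) ∂law
      ≤ ∑ t ∈ Finset.range T, ENNReal.ofReal M := by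
        refine Finset.sum_le_sum fun t _ => ?_
        refine (lintegral_mono fun ω => ENNReal.ofReal_le_ofReal (h t ω)).trans_eq ?_
        simp
    _ = ENNReal.ofReal M * T := by simp [mul_comm]

/-- Lyapunov drift: a queue is strongly stable if its services are bounded, independent of the
queue length, and larger in the mean than the average `l` of the arrivals, which may deviate from
linear growth by a bounded deterministic amount `f`. -/
lemma stronglyStable_of_drift [IsProbabilityMeasure law] {X s : ℕ → Ω → ℝ} {f : ℕ → ℝ} {l m S W : ℝ}
    (hX0 : ∀ t ω, 0 ≤ X t ω) (hXm : ∀ t, Measurable (X t)) (hXb : ∀ t, ∃ C, ∀ ω, X t ω ≤ C)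
    (hs0 : ∀ t ω, 0 ≤ s t ω) (hsS : ∀ t ω, s t ω ≤ S) (hsm : ∀ t, Measurable (s t))
    (hsE : ∀ t, ∫ ω, s t ω ∂law = m) (hind : ∀ t, IndepFun (X t) (s t) law)
    (hf0 : ∀ t, f t ≤ 0) (hfW : ∀ t, -W ≤ f t) (hl : 0 ≤ l) (hlm : l < m)
    (hstep : ∀ t ω, X (t + 1) ω = max (X t ω - s t ω) 0 + (l + f (t + 1) - f t)) :
    StronglyStable law X := by
  -- Subtracting `f` cancels the fluctuation of the arrivals: without truncation at zero, `V`
  -- changes by exactly `l - s`. In `B`, the first square bounds `(l - s) ^ 2` and the second the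
  -- value of `V ^ 2` after a truncation.
  set V : ℕ → Ω → ℝ := fun t ω => X t ω - f t with hV
  set B : ℝ := (l + S) ^ 2 + (l + W) ^ 2
  have hV0 : ∀ t ω, 0 ≤ V t ω := fun t ω => by
    have := hX0 t ω; have := hf0 t; simp only [hV]; linarith
  have hVm : ∀ t, Measurable (V t) := fun t => (hXm t).sub_const _
  have hXi : ∀ t, Integrable (X t) law := by
    intro t
    obtain ⟨C, hC⟩ := hXb t
    exact Integrable.of_bound (hXm t).aestronglyMeasurable C (ae_of_all _ fun ω => by
      rw [Real.norm_of_nonneg (hX0 t ω)]; exact hC ω)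
  have hVi : ∀ t, Integrable (V t) law := fun t => (hXi t).sub (integrable_const _)
  have hV2i : ∀ t, Integrable (fun ω => V t ω ^ 2) law := by
    intro t
    obtain ⟨C, hC⟩ := hXb t
    refine Integrable.of_bound ((hVm t).pow_const 2).aestronglyMeasurable ((C - f t) ^ 2)
      (ae_of_all _ fun ω => ?_)
    rw [Real.norm_of_nonneg (sq_nonneg _)]
    exact pow_le_pow_left₀ (hV0 t ω) (by have := hC ω; simp only [hV]; linarith) 2
  have hsi : ∀ t, Integrable (s t) law := fun t =>
    Integrable.of_bound (hsm t).aestronglyMeasurable S (ae_of_all _ fun ω => by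
      rw [Real.norm_of_nonneg (hs0 t ω)]; exact hsS t ω)
  have hVind : ∀ t, IndepFun (V t) (s t) law := fun t =>
    (hind t).comp (φ := fun x => x - f t) (ψ := id) (by fun_prop) measurable_id
  have hVsi : ∀ t, Integrable (fun ω => V t ω * s t ω) law := fun t =>
    (hVind t).integrable_mul (hVi t) (hsi t)
  have hdrift : ∀ t ω, V (t + 1) ω ^ 2 ≤ V t ω ^ 2 + 2 * l * V t ω - 2 * (V t ω * s t ω) + B := by
    intro t ω
    have h1 := hV0 t ω
    have h2 := hs0 t ω
    have h3 := hsS t ω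
    have h4 := hf0 t
    have h5 := hfW t
    have hsl : (l - s t ω) ^ 2 ≤ (l + S) ^ 2 := by
      apply sq_le_sq' <;> linarith
    have e1 : V (t + 1) ω = max (X t ω - s t ω) 0 + (l - f t) := by
      simp only [hV, hstep]; ring
    rcases le_total 0 (X t ω - s t ω) with h | h
    · rw [max_eq_left h] at e1
      have e2 : V (t + 1) ω = V t ω + (l - s t ω) := by rw [e1]; simp only [hV]; ring
      rw [e2]
      nlinarith [sq_nonneg (l + W)]
    · rw [max_eq_right h, zero_add] at e1
      have h6 : (l - f t) ^ 2 ≤ (l + W) ^ 2 := by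
        apply sq_le_sq' <;> linarith
      rw [e1]
      -- Here `V ^ 2 + 2 * l * V - 2 * V * s` equals `(V + (l - s)) ^ 2 - (l - s) ^ 2`, hence is at
      -- least `-(l + S) ^ 2`.
      nlinarith [sq_nonneg (V t ω + (l - s t ω))]
  -- Independence turns the mean of `V * s` into `m` times the mean of `V`, so the drift is at most
  -- `B - 2 * (m - l) * E[V]`; summation over time then bounds the average of `E[V]`.
  have hmean : ∀ t, ∫ ω, V (t + 1) ω ^ 2 ∂law ≤
      ∫ ω, V t ω ^ 2 ∂law - 2 * (m - l) * ∫ ω, V t ω ∂law + B := by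
    intro t
    have i1 : Integrable (fun ω => V t ω ^ 2 + 2 * l * V t ω) law :=
      (hV2i t).add ((hVi t).const_mul _)
    have i2 : Integrable (fun ω => V t ω ^ 2 + 2 * l * V t ω - 2 * (V t ω * s t ω)) law :=
      i1.sub ((hVsi t).const_mul _)
    have h1 := integral_mono (hV2i (t + 1)) (i2.add (integrable_const B)) (hdrift t)
    refine h1.trans_eq ?_
    have h2 := (hVind t).integral_fun_mul_eq_mul_integral (hVm t).aestronglyMeasurable
      (hsm t).aestronglyMeasurable
    rw [hsE] at h2
    simp only [Pi.add_apply]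
    rw [integral_add i2 (integrable_const B), integral_sub i1 ((hVsi t).const_mul _),
      integral_add (hV2i t) ((hVi t).const_mul _), integral_const_mul, integral_const_mul, h2,
      integral_const, probReal_univ, one_smul]
    ring
  have hsum : ∀ T, 2 * (m - l) * ∑ t ∈ Finset.range T, ∫ ω, V t ω ∂law +
      ∫ ω, V T ω ^ 2 ∂law ≤ ∫ ω, V 0 ω ^ 2 ∂law + B * T := by
    intro T
    induction T with
    | zero => simp
    | succ T ih =>
      have := hmean T
      rw [Finset.sum_range_succ]
      push_cast
      linarith
  have hε : 0 < 2 * (m - l) := by linarith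
  refine stronglyStable_of_le (M := ENNReal.ofReal ((∫ ω, V 0 ω ^ 2 ∂law + B) / (2 * (m - l))))
    ENNReal.ofReal_ne_top fun T hT => ?_
  rw [timeAverage_eq_ofReal hXi hX0]
  apply ENNReal.ofReal_le_ofReal
  have hTr : (1 : ℝ) ≤ T := by exact_mod_cast hT
  rw [le_div_iff₀ hε]
  have h1 : ∑ t ∈ Finset.range T, ∫ ω, X t ω ∂law ≤ ∑ t ∈ Finset.range T, ∫ ω, V t ω ∂law :=
    Finset.sum_le_sum fun t _ => integral_mono (hXi t) (hVi t) fun ω => by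
      have := hf0 t; simp only [hV]; linarith
  have h2 := hsum T
  have h3 : 0 ≤ ∫ ω, V T ω ^ 2 ∂law := integral_nonneg fun ω => sq_nonneg _
  have h4 : 0 ≤ ∫ ω, V 0 ω ^ 2 ∂law := integral_nonneg fun ω => sq_nonneg _
  have h5 := mul_le_mul_of_nonneg_left h1 hε.le
  have h6 : (∑ t ∈ Finset.range T, ∫ ω, X t ω ∂law) * (2 * (m - l)) ≤
      T * (∫ ω, V 0 ω ^ 2 ∂law + B) := by nlinarith
  calc (T : ℝ)⁻¹ * (∑ t ∈ Finset.range T, ∫ ω, X t ω ∂law) * (2 * (m - l))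
      = (T : ℝ)⁻¹ * ((∑ t ∈ Finset.range T, ∫ ω, X t ω ∂law) * (2 * (m - l))) := by ring
    _ ≤ (T : ℝ)⁻¹ * (T * (∫ ω, V 0 ω ^ 2 ∂law + B)) := by gcongr
    _ = _ := by
      have : (T : ℝ) ≠ 0 := by positivity
      field_simp

end Queues

/-- A queue with deterministic arrivals of average `l` and departures of average at least `l`, both
within a bounded distance from linear growth, is bounded. -/
lemma queue_le_of_deviation {X f g : ℕ → ℝ} {l d W : ℝ} (hld : l ≤ d)
    (hf0 : ∀ t, f t ≤ 0) (hf1 : ∀ t, -1 ≤ f t) (hg0 : ∀ t, g t ≤ 0) (hgW : ∀ t, -W ≤ g t)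
    (hstep : ∀ t, X (t + 1) =
      max (X t - (d + g (t + 1) - g t)) 0 + (l + f (t + 1) - f t)) (t : ℕ) :
    X t ≤ max (X 0 + 1) (l + 1) + W := by
  -- Without truncation this combination changes by `l - d ≤ 0`; a truncation resets it to at most
  -- `l + 1`.
  have h : ∀ t, X t - f t + g t ≤ max (X 0 + 1) (l + 1) := by
    intro t
    induction t with
    | zero =>
      have := le_max_left (X 0 + 1) (l + 1)
      have := hf1 0
      have := hg0 0
      linarith
    | succ t ih =>
      rw [hstep]
      rcases le_total 0 (X t - (d + g (t + 1) - g t)) with h | h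
      · rw [max_eq_left h]
        linarith
      · rw [max_eq_right h]
        have := le_max_right (X 0 + 1) (l + 1)
        have := hf1 t
        have := hg0 (t + 1)
        linarith
  have := h t
  have := hf0 t
  have := hgW t
  linarith

namespace Network

variable {K : ℕ} {H : Type*} [Fintype H] {net : Network K H}

namespace ControlledSystem

variable (sys : net.ControlledSystem)

lemma codeQueue_nonneg (I : UserSet K) (t : ℕ) (ω : sys.Ω) : 0 ≤ sys.codeQueue I t ω := by
  cases t with
  | zero => simp [codeQueue]
  | succ t =>
    exact add_nonneg (le_max_right _ _) (Finset.sum_nonneg fun J _ =>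
      mul_nonneg (net.bits_nonneg J I) (Nat.cast_nonneg _))

/-- The shift of index is the point: the queue at time `t + 1` is determined by the slots up to `t`,
hence is independent of the channel state that it meets. -/
lemma codeQueue_measurable (I : UserSet K) (t : ℕ) :
    Measurable[sys.info t] (sys.codeQueue I (t + 1)) := by
  have hstep : ∀ t, Measurable[sys.info t] (sys.codeQueue I t) →
      Measurable[sys.info t] (sys.codeQueue I (t + 1)) := by
    intro t ht
    have hsum : Measurable[sys.info t] fun ω =>
        ∑ J : UserSet K with I.1 ⊆ J.1, net.bits J I * (sys.comb t J ω : ℝ) :=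
      Finset.measurable_fun_sum _ fun J _ =>
        (measurable_from_top.comp (sys.comb_measurable t J)).const_mul _
    exact ((ht.sub ((sys.rate_measurable t I).const_mul _)).max measurable_const).add hsum
  induction t with
  | zero => exact hstep 0 measurable_const
  | succ t ih => exact hstep (t + 1) (ih.mono (sys.info.mono t.le_succ) le_rfl)

lemma measurable_codeQueue (I : UserSet K) (t : ℕ) : Measurable (sys.codeQueue I t) := by
  cases t with
  | zero => exact measurable_const
  | succ t => exact (sys.codeQueue_measurable I t).mono (sys.info.le t) le_rfl

/-- The bound depends on `t`; it serves only to make moments finite in the drift argument. -/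
lemma exists_codeQueue_le (I : UserSet K) (t : ℕ) : ∃ C, ∀ ω, sys.codeQueue I t ω ≤ C := by
  induction t with
  | zero => exact ⟨net.codeInit I, fun ω => le_rfl⟩
  | succ t ih =>
    obtain ⟨C, hC⟩ := ih
    refine ⟨max C 0 + ∑ J : UserSet K with I.1 ⊆ J.1, net.bits J I * net.combMax, fun ω => ?_⟩
    refine add_le_add (max_le_max_right _ ?_) (Finset.sum_le_sum fun J _ =>
      mul_le_mul_of_nonneg_left (Nat.cast_le.2 (sys.comb_le t J ω)) (net.bits_nonneg J I))
    have := mul_nonneg net.slot_pos.le (sys.rate_nonneg t I ω)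
    have := hC ω
    linarith

lemma integral_channel (t : ℕ) (g : H → ℝ) :
    ∫ ω, g (sys.channel t ω) ∂sys.law = ∑ s, net.prob s * g s := by
  classical
  have h1 : ∀ ω, g (sys.channel t ω) =
      ∑ s, ({ω | sys.channel t ω = s}).indicator (fun _ => g s) ω := by
    intro ω
    simp [Set.indicator_apply]
  simp only [h1]
  rw [integral_finsetSum _ fun s _ =>
    (integrable_const (g s)).indicator (sys.measurableSet_channel t s)]
  refine Finset.sum_congr rfl fun s _ => ?_
  rw [integral_indicator_const _ (sys.measurableSet_channel t s), Measure.real, sys.channel_law,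
    ENNReal.toReal_ofReal (net.prob_nonneg s), smul_eq_mul]

/-- A controlled system is stable if it combines files in a regular way at average numbers `c`
which support the admission rates `a` and which leave slack to the codeword queues. -/
lemma stable_of_floorIncrement {a : Fin K → ℝ≥0} {c u : UserSet K → ℝ} {r : H → UserSet K → ℝ}
    (hadm : ∀ t k ω, sys.admitted t k ω = floorIncrement (a k) t)
    (hcomb : ∀ t J ω, sys.comb t J ω = floorIncrement (c J) t)
    (hrate : ∀ t I ω, sys.rate t I ω = r (sys.channel t ω) I)
    (hc : ∀ J, 0 ≤ c J) (hu : u = ∑ s, net.prob s • r s)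
    (hk : ∀ k, (a k : ℝ) ≤ ∑ J : UserSet K with k ∈ J.1, c J)
    (hI : ∀ I : UserSet K, (∑ J : UserSet K with I.1 ⊆ J.1, net.bits J I * c J < net.slot * u I) ∨
      ∀ J : UserSet K, I.1 ⊆ J.1 → net.bits J I * c J = 0) :
    sys.Stable := by
  constructor
  · intro k
    refine stronglyStable_of_bounded (M := max ((net.userInit k : ℝ) + 1) ((a k : ℝ) + 1) +
      ∑ J : UserSet K with k ∈ J.1, (1 : ℝ)) fun t ω => ?_
    have h := queue_le_of_deviation (X := fun t => sys.userQueue k t ω)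
      (f := floorDeviation (a k)) (l := a k) (d := ∑ J : UserSet K with k ∈ J.1, c J)
      (g := fun t => ∑ J : UserSet K with k ∈ J.1, floorDeviation (c J) t)
      (W := ∑ J : UserSet K with k ∈ J.1, (1 : ℝ)) (hk k)
      (floorDeviation_nonpos (a k).coe_nonneg) (neg_one_le_floorDeviation _)
      (fun t => Finset.sum_nonpos fun J _ => floorDeviation_nonpos (hc J) t)
      (fun t => by
        rw [← Finset.sum_neg_distrib]
        exact Finset.sum_le_sum fun J _ => neg_one_le_floorDeviation _ t)
      (fun t => by
        simp only [userQueue, hadm, hcomb, floorIncrement_eq (hc _), floorIncrement_eq (a k).coe_nonneg,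
          Finset.sum_add_distrib, Finset.sum_sub_distrib]) t
    simpa only [userQueue] using h
  · intro I
    -- Either the service has strict slack and the drift argument applies, or no bits ever arrive
    -- and the queue cannot grow beyond its initial content.
    rcases hI I with hI | hI
    · obtain ⟨L, hL0, hL⟩ := net.exists_rate_bound
      refine stronglyStable_of_drift (s := fun t ω => net.slot * sys.rate t I ω)
        (f := fun t => ∑ J : UserSet K with I.1 ⊆ J.1, net.bits J I * floorDeviation (c J) t)
        (l := ∑ J : UserSet K with I.1 ⊆ J.1, net.bits J I * c J) (m := net.slot * u I)
        (S := net.slot * L) (W := ∑ J : UserSet K with I.1 ⊆ J.1, net.bits J I)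
        (sys.codeQueue_nonneg I) (sys.measurable_codeQueue I) (sys.exists_codeQueue_le I)
        (fun t ω => mul_nonneg net.slot_pos.le (sys.rate_nonneg t I ω))
        (fun t ω => mul_le_mul_of_nonneg_left (hL _ _ (sys.rate_mem t ω) I) net.slot_pos.le)
        (fun t => (sys.measurable_rate t I).const_mul _) (fun t => ?_) (fun t => ?_)
        (fun t => Finset.sum_nonpos fun J _ => mul_nonpos_of_nonneg_of_nonpos
          (net.bits_nonneg J I) (floorDeviation_nonpos (hc J) t))
        (fun t => ?_)
        (Finset.sum_nonneg fun J _ => mul_nonneg (net.bits_nonneg J I) (hc J)) hI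
        (fun t ω => ?_)
      · simp only [hrate]
        rw [integral_const_mul, sys.integral_channel t fun s => r s I, hu]
        simp
      · cases t with
        | zero => exact indepFun_const_left _ _
        | succ t =>
          have hs : (fun ω => net.slot * sys.rate (t + 1) I ω) =
              (fun s => net.slot * r s I) ∘ sys.channel (t + 1) := by
            funext ω
            simp [hrate]
          rw [IndepFun_iff_Indep, hs, ← MeasurableSpace.comap_comp]
          exact indep_of_indep_of_le_left (indep_of_indep_of_le_right (sys.channel_indep t)
            (MeasurableSpace.comap_mono le_top)) (sys.codeQueue_measurable I t).comap_le
      · rw [← Finset.sum_neg_distrib]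
        refine Finset.sum_le_sum fun J _ => ?_
        have := mul_le_mul_of_nonneg_left (neg_one_le_floorDeviation (c J) t) (net.bits_nonneg J I)
        linarith
      · simp only [codeQueue, hcomb, floorIncrement_eq (hc _), mul_add, mul_sub,
          Finset.sum_add_distrib, Finset.sum_sub_distrib]
    · refine stronglyStable_of_bounded (M := net.codeInit I) fun t ω => ?_
      induction t with
      | zero => exact le_rfl
      | succ t ih =>
        have h0 : ∑ J : UserSet K with I.1 ⊆ J.1, net.bits J I * (sys.comb t J ω : ℝ) = 0 := by
          refine Finset.sum_eq_zero fun J hJ => ?_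
          rcases mul_eq_zero.1 (hI J (Finset.mem_filter.1 hJ).2) with h | h
          · rw [h, zero_mul]
          · rw [hcomb, h, floorIncrement_zero, Nat.cast_zero, mul_zero]
        simp only [codeQueue]
        rw [h0, add_zero]
        have := mul_nonneg net.slot_pos.le (sys.rate_nonneg t I ω)
        exact max_le (by linarith) (net.codeInit I).2

lemma hasAdmissionRate_of_floorIncrement {a : Fin K → ℝ≥0}
    (hadm : ∀ t k ω, sys.admitted t k ω = floorIncrement (a k) t) : sys.HasAdmissionRate a := by
  have h : ∀ k, Tendsto (sys.admissionAverage k) atTop (𝓝 (a k : ℝ≥0∞)) := by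
    intro k
    have h1 : sys.admissionAverage k =
        fun T : ℕ => ENNReal.ofReal ((⌊(a k : ℝ) * T⌋₊ : ℝ) / (T : ℝ)) := by
      funext T
      rw [admissionAverage]
      simp only [hadm]
      rw [timeAverage_eq_ofReal (fun t => integrable_const _) fun t ω => Nat.cast_nonneg _]
      simp only [integral_const, probReal_univ, one_smul]
      rw [sum_floorIncrement (a k).coe_nonneg, div_eq_inv_mul]
    rw [h1, ← ENNReal.ofReal_coe_nnreal]
    exact ENNReal.tendsto_ofReal
      ((tendsto_nat_floor_mul_div_atTop (a k).coe_nonneg).comp tendsto_natCast_atTop_atTop)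
  exact ⟨fun k => (h k).limsup_eq, id, tendsto_id, h⟩

end ControlledSystem

/-! ### The queue-independent policy on a product space. -/

section Stationary

variable (net)

/-- The law of the channel state, with the states numbered. -/
noncomputable def channelLaw : Measure (Fin (Fintype.card H)) :=
  ∑ i, ENNReal.ofReal (net.prob ((Fintype.equivFin H).symm i)) • Measure.dirac i

lemma channelLaw_singleton (i : Fin (Fintype.card H)) :
    net.channelLaw {i} = ENNReal.ofReal (net.prob ((Fintype.equivFin H).symm i)) := by
  simp [channelLaw, Measure.finsetSum_apply, Set.indicator_apply]

instance : IsProbabilityMeasure net.channelLaw := by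
  constructor
  simp only [channelLaw, Measure.finsetSum_apply, Measure.smul_apply, measure_univ, smul_eq_mul,
    mul_one]
  rw [← ENNReal.ofReal_sum_of_nonneg fun i _ => net.prob_nonneg _,
    Equiv.sum_comp (Fintype.equivFin H).symm net.prob, net.prob_sum, ENNReal.ofReal_one]

/-- The information given by the coordinates up to a time. -/
def coordinateFiltration (n : ℕ) :
    Filtration ℕ (MeasurableSpace.pi : MeasurableSpace (ℕ → Fin n)) where
  seq t := ⨆ j ∈ Set.Iic t, MeasurableSpace.comap (fun ω : ℕ → Fin n => ω j) ⊤
  mono' _ _ h := biSup_mono fun _ hj => le_trans hj h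
  le' _ := iSup₂_le fun j _ => (measurable_pi_apply j).comap_le

lemma measurable_coordinate {n t : ℕ} :
    @Measurable _ _ (coordinateFiltration n t) ⊤ (fun ω : ℕ → Fin n => ω t) := by
  rw [measurable_iff_comap_le]
  exact le_biSup (fun j => MeasurableSpace.comap (fun ω : ℕ → Fin n => ω j) ⊤)
    (Set.mem_Iic.2 (le_refl t))

/-- The system in which the channel states are the coordinates of a product space, admissions and
combinations follow fixed sequences, and the rates depend on the channel state only. -/
noncomputable def stationarySystem (r : H → UserSet K → ℝ)
    (hr : ∀ s, r s ∈ capacityRegion net.power (net.gain s)) (adm : ℕ → Fin K → ℕ)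
    (comb : ℕ → UserSet K → ℕ) (hcomb : ∀ t J, comb t J ≤ net.combMax) :
    net.ControlledSystem where
  -- Numbering the states keeps `Ω` in `Type` although `H` may live in any universe.
  Ω := ℕ → Fin (Fintype.card H)
  law := Measure.infinitePi fun _ => net.channelLaw
  info := coordinateFiltration (Fintype.card H)
  channel t ω := (Fintype.equivFin H).symm (ω t)
  admitted t k _ := adm t k
  comb t J _ := comb t J
  rate t I ω := r ((Fintype.equivFin H).symm (ω t)) I
  channel_measurable t := by
    intro A _
    exact measurable_coordinate
      (show MeasurableSet[⊤] ((Fintype.equivFin H).symm ⁻¹' A) from trivial)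
  admitted_measurable _ _ := measurable_const
  comb_measurable _ _ := measurable_const
  rate_measurable t I := by
    exact (measurable_from_top (f := fun i => r ((Fintype.equivFin H).symm i) I)).comp
      measurable_coordinate
  channel_law t s := by
    have h1 : {ω : ℕ → Fin (Fintype.card H) | (Fintype.equivFin H).symm (ω t) = s} =
        (fun ω => ω t) ⁻¹' {Fintype.equivFin H s} := by
      ext ω
      simp [Equiv.symm_apply_eq]
    rw [h1, ← Measure.map_apply (measurable_pi_apply t) (MeasurableSet.singleton _),
      Measure.infinitePi_map_eval, channelLaw_singleton, Equiv.symm_apply_apply]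
  channel_indep t := by
    have h1 : iIndepFun (fun (j : ℕ) (ω : ℕ → Fin (Fintype.card H)) => ω j)
        (Measure.infinitePi fun _ => net.channelLaw) :=
      iIndepFun_infinitePi (P := fun _ : ℕ => net.channelLaw) (X := fun _ i => i)
        fun _ => measurable_id
    have h2 := indep_iSup_of_disjoint (fun j => (measurable_pi_apply j).comap_le)
      ((iIndepFun_iff_iIndep _ _ _).1 h1) (S := Set.Iic t) (T := {t + 1}) (by simp)
    rw [iSup_singleton] at h2
    refine indep_of_indep_of_le_right h2 ?_
    have h3 : (fun ω : ℕ → Fin (Fintype.card H) => (Fintype.equivFin H).symm (ω (t + 1))) =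
        (Fintype.equivFin H).symm ∘ fun ω => ω (t + 1) := rfl
    rw [h3, ← MeasurableSpace.comap_comp]
    exact MeasurableSpace.comap_mono le_top
  comb_le t J _ := hcomb t J
  rate_mem _ _ := hr _

theorem interior_region_subset_stabilityRegion :
    interior net.region ⊆ net.stabilityRegion := by
  intro a ha
  obtain ⟨c, u, δ, hδ0, hδ1, hc, ⟨r, hr, hu⟩, hk, hI⟩ := net.exists_slack ha
  have h1 : 0 < 1 - δ := by linarith
  have hc0 : ∀ J, 0 ≤ (1 - δ) * c J := fun J => mul_nonneg h1.le (hc J).1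
  have hcle : ∀ J, (1 - δ) * c J ≤ net.combMax := fun J =>
    (mul_le_of_le_one_left (hc J).1 (by linarith)).trans (hc J).2
  refine ⟨net.stationarySystem r hr (fun t k => floorIncrement (a k) t)
    (fun t J => floorIncrement ((1 - δ) * c J) t)
    (fun t J => floorIncrement_le (hc0 J) (hcle J) t),
    ControlledSystem.hasAdmissionRate_of_floorIncrement _ fun t k ω => rfl,
    ControlledSystem.stable_of_floorIncrement _ (a := a) (c := fun J => (1 - δ) * c J) (u := u)
      (r := r) (fun t k ω => rfl) (fun t J ω => rfl) (fun t I ω => rfl) hc0 hu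
      (fun k => by simpa only [← Finset.mul_sum] using (hk k).le) fun I => ?_⟩
  have hb : ∀ J, 0 ≤ net.bits J I * c J := fun J => mul_nonneg (net.bits_nonneg J I) (hc J).1
  have hsum : ∑ J : UserSet K with I.1 ⊆ J.1, net.bits J I * ((1 - δ) * c J) =
      (1 - δ) * ∑ J : UserSet K with I.1 ⊆ J.1, net.bits J I * c J := by
    rw [Finset.mul_sum]
    exact Finset.sum_congr rfl fun J _ => by ring
  -- Shrinking by `1 - δ` makes the inequality strict only if the load is positive. A zero load has
  -- all its terms zero, so this queue is never fed.
  rcases (Finset.sum_nonneg (s := Finset.univ.filter fun J : UserSet K => I.1 ⊆ J.1)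
    fun J _ => hb J).eq_or_lt with h | h
  · right
    intro J hJ
    have h2 := (Finset.sum_eq_zero_iff_of_nonneg fun J _ => hb J).1 h.symm J
      (Finset.mem_filter.2 ⟨Finset.mem_univ J, hJ⟩)
    linear_combination (1 - δ) * h2
  · left
    rw [hsum]
    refine lt_of_lt_of_le ?_ (hI I)
    exact mul_lt_of_lt_one_left h (by linarith)

end Stationary

end Network

end CodedCaching

/-- Off the boundary of `Γ^CC`, the stability region is the interior of `Γ^CC` (relative to the
space `ℝ₊^K` of rate vectors); and the interior of `Γ^CC` is where its inequalities can be
satisfied strictly, provided that all users have a positive gain in some possible state. -/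
theorem theorem3 {K : ℕ} {H : Type*} [Fintype H] (net : CodedCaching.Network K H) :
    (∀ a : Fin K → ℝ≥0, a ∉ frontier net.region →
      (a ∈ net.stabilityRegion ↔ a ∈ interior net.region)) ∧
    ((∃ s, 0 < net.prob s ∧ ∀ k, 0 < net.gain s k) →
      interior net.region = net.strictRegion) := by
  refine ⟨fun a ha => ⟨fun h => ?_, fun h => ?_⟩, net.interior_region_eq_strictRegion⟩
  · rw [← self_sdiff_frontier]
    exact ⟨CodedCaching.Network.stabilityRegion_subset_region h, ha⟩
  · exact net.interior_region_subset_stabilityRegion h
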